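/- \textbf{Setting.} A decentralized problem consists of a finite set of $n$ nodes, differentiable local functions $f_1,\dots,f_n:\ell_2\to\mathbb R$, and, for every time step $k=0,1,2,\dots$, an undirected loopless graph $\mathcal G_k$ on the nodes with a matrix $W_k\in\mathbb R^{n\times n}$. The global function is $f=\frac1n\sum_{i=1}^n f_i$. A function $h$ is $L$-smooth if $\|\nabla h(y)-\nabla h(x)\|\le L\|y-x\|$ for all $x,y$, and $\mu$-strongly convex if $h(y)\ge h(x)+\langle\nabla h(x),y-x\rangle+\frac\mu2\|y-x\|^2$ for all $x,y$. A \emph{first-order decentralized method} with starting point $x_0\in\ell_2$ maintains on each problem local memories $\mathcal H_i(k)\subseteq\ell_2$ of the nodes $i$ at times $k\ge0$, with $\mathcal H_i(0)=\{x_0\}$. Each time step $k$ is either a local computation, in which $$\mathcal H_i(k+1)\subseteq\operatorname{span}\{x,\nabla f_i(x),\nabla f_i^*(x): x\in\mathcal H_i(k)\}\quad\text{for all } i,$$ where $f_i^*(y)=\sup_x\{\langle y,x\rangle-f_i(x)\}$, or a communication round, in which $$\mathcal H_i(k+1)\subseteq\operatorname{span}\Big(\mathcal H_i(k)\cup\bigcup_{j:\,\{i,j\}\in\mathcal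 E(\mathcal G_k)}\mathcal H_j(k)\Big)\quad\text{for all } i.$$ The method may choose the type of each step and the contents of the memories subject to these inclusions in an arbitrary way, which may depend on the problem; $x_0$ does not depend on the problem. A matrix $W$ is a gossip matrix of a graph $\mathcal G$ if $W_{ij}=0$ whenever $i\ne j$ and $\{i,j\}$ is not an edge, and $\ker W$ is the set of constant vectors. Write $\chi(W)=\lambda_{\max}(W)/\lambda_{\min}^+(W)$ for the ratio of the largest to the smallest positive eigenvalue. \textbf{Theorem.} Let $\chi\ge56$ and $L>16\mu>0$, and let a first-order decentralized method with starting point $x_0$ be given. Then there is a decentralized problem such that (a) every local function $f_i$ is $L$-smooth and $\mu$-strongly convex; (b) for every $k\ge0$, the edge sets of $\mathcal G_k$ and $\mathcal G_{k+1}$ differ in at most two edges (an edge removed or added counts as one); (c) for every $k\ge0$, $W_k$ is the Laplacian of $\mathcal G_k$ for some positive edge weights, is a gossip matrix of $\mathcal G_k$, and has $\chi(W_k)=\chi$; (d) $f$ has a minimizer $x^*\neq x_0$, and for every $k\ge0$, every node $i$ and every vector $x_k\in\mathcal H_i(k)$, $$\|x_k-x^*\|^2\ \ge\ \Big(1-4\sqrt{\mu/L}\Big)^{\frac{72k}{7\chi}+2}\,\|x_0-x^*\|^2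 .$$ -/

import Mathlib

open Set

noncomputable section

/-- The real Hilbert space `ℓ₂` of square-summable sequences. -/
abbrev Ell2 : Type := lp (fun _ : ℕ => ℝ) 2

/-- `h` is `L`-smooth: differentiable, with `L`-Lipschitz gradient. -/
def IsLSmooth (L : ℝ) (h : Ell2 → ℝ) : Prop :=
  Differentiable ℝ h ∧ ∀ x y : Ell2, ‖gradient h y - gradient h x‖ ≤ L * ‖y - x‖

/-- `h` is (differentiable and) `μ`-strongly convex. -/
def IsMuStronglyConvex (μ : ℝ) (h : Ell2 → ℝ) : Prop :=
  Differentiable ℝ h ∧ ∀ x y : Ell2,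
    h x + inner ℝ (gradient h x) (y - x) + μ / 2 * ‖y - x‖ ^ 2 ≤ h y

/-- The Fenchel conjugate `h*(y) = sup_x (⟨y, x⟩ - h x)`; for strongly convex `h` the supremum
is finite. -/
def fenchelConjugate (h : Ell2 → ℝ) (y : Ell2) : ℝ :=
  ⨆ x : Ell2, (inner ℝ y x - h x)

/-- `A` is the weighted adjacency matrix of a weighted graph with underlying graph `G`: it is
symmetric, positive on the edges of `G`, and zero elsewhere (in particular on the diagonal). -/
def IsWeightedAdjacency {n : ℕ} (G : SimpleGraph (Fin n)) (A : Matrix (Fin n) (Fin n) ℝ) : Prop :=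
  A.IsSymm ∧ (∀ i j, G.Adj i j → 0 < A i j) ∧ (∀ i j, ¬ G.Adj i j → A i j = 0)

/-- The Laplacian of the weighted graph with weighted adjacency matrix `A`: the weighted degrees on
the diagonal minus `A`. -/
def weightedLaplacian {n : ℕ} (A : Matrix (Fin n) (Fin n) ℝ) : Matrix (Fin n) (Fin n) ℝ :=
  Matrix.diagonal (fun i => ∑ k, A i k) - A

/-- `W` is the Laplacian of `G` for some choice of positive edge weights. -/
def IsWeightedLaplacianOf {n : ℕ} (G : SimpleGraph (Fin n))
    (W : Matrix (Fin n) (Fin n) ℝ) : Prop :=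
  ∃ A : Matrix (Fin n) (Fin n) ℝ, IsWeightedAdjacency G A ∧ W = weightedLaplacian A

/-- `W` is a gossip matrix of `G`: its off-diagonal entries vanish off the edges of `G`, and its
kernel consists exactly of the constant vectors. -/
def IsGossipMatrix {n : ℕ} (G : SimpleGraph (Fin n)) (W : Matrix (Fin n) (Fin n) ℝ) : Prop :=
  (∀ i j, i ≠ j → ¬ G.Adj i j → W i j = 0) ∧
    ∀ x : Fin n → ℝ, W.mulVec x = 0 ↔ ∀ i j, x i = x j

/-- `χ(W) = χ`: the largest eigenvalue of `W` divided by its smallest positive eigenvalue (both of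
which exist) equals `χ`. -/
def HasConditionNumber {n : ℕ} (W : Matrix (Fin n) (Fin n) ℝ) (χ : ℝ) : Prop :=
  ∃ lmax lmin : ℝ, IsGreatest (spectrum ℝ W) lmax ∧
    IsLeast {t : ℝ | t ∈ spectrum ℝ W ∧ 0 < t} lmin ∧ lmax / lmin = χ

/-- The data of a decentralized optimization problem: `n` nodes, the local function `f i` of each
node `i`, and, for each time step `k`, the communication graph `G k` and a matrix `W k`. -/
structure DecentralizedProblem where
  n : ℕ
  f : Fin n → Ell2 → ℝ
  G : ℕ → SimpleGraph (Fin n)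
  W : ℕ → Matrix (Fin n) (Fin n) ℝ

/-- The global function: the average of the local functions. -/
def DecentralizedProblem.globalFunction (P : DecentralizedProblem) (x : Ell2) : ℝ :=
  (1 / (P.n : ℝ)) * ∑ i, P.f i x

/-- A first-order decentralized method with starting point `x₀`. On a problem `P` it decides which
time steps are communication rounds (`isComm P k`) and which are local computations, and it
determines the local memory `memory P k i` of node `i` at time `k`. The schedule and the choice of
what is stored may depend on the whole problem; the memories are only restricted by the span
conditions. -/
structure FirstOrderMethod where
  x₀ : Ell2
  isComm : DecentralizedProblem → ℕ → Prop
  memory : (P : DecentralizedProblem) → ℕ → Fin P.n → Set Ell2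
  memory_zero : ∀ (P : DecentralizedProblem) (i : Fin P.n), memory P 0 i = {x₀}
  memory_local : ∀ (P : DecentralizedProblem) (k : ℕ), ¬ isComm P k → ∀ i : Fin P.n,
    memory P (k + 1) i ⊆
      Submodule.span ℝ (⋃ x ∈ memory P k i,
        {x, gradient (P.f i) x, gradient (fenchelConjugate (P.f i)) x})
  memory_comm : ∀ (P : DecentralizedProblem) (k : ℕ), isComm P k → ∀ i : Fin P.n,
    memory P (k + 1) i ⊆
      Submodule.span ℝ (⋃ j ∈ {j : Fin P.n | (P.G k).Adj i j ∨ j = i}, memory P k j)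

end

/-!
A quadratic chain `μ ‖y‖² / 2 + c ∑ (yᵢ - yᵢ₊₁)² / 2 - (μ + c (1 - q)) y₀`, with `y = x - x₀` and
orthonormal coordinates orthogonal to `x₀`, is minimized at `yᵢ = qⁱ`. Its odd links are given to
one group of nodes and its even links to another. A local computation then discovers at most one
new coordinate, and only at a node of the group holding the right links, so two consecutive
coordinates are separated by a journey of the information from one group to the other. Since a
point known after the discovery of `m` coordinates misses the entries `qⁱ`, `i ≥ m`, of the
minimizer, its squared distance to the minimizer is at least `q ^ (2 * m)` times the initial one.

The graph consists of two stars joined by a bridge node. Moving one leaf at a time from one star to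
the other changes two edges per step, and the information can only follow the bridge, so that the
journey takes time proportional to the number `n` of nodes. The Laplacian of such a graph with all
edges at a bounded weight has condition number of order `n`; adding weight to an edge increases the
largest eigenvalue continuously without decreasing the smallest positive one, so that any `χ ≥ 3 n`
is attained by suitable weights.
-/

section QuadraticObjective

variable {H : Type*} [NormedAddCommGroup H] [InnerProductSpace ℝ H]

/-- The quadratic function with Hessian `A` whose gradient at `x₀` is `-b`. -/
noncomputable def quadraticObjective (A : H →L[ℝ] H) (b x₀ x : H) : ℝ :=
  inner ℝ (A (x - x₀)) (x - x₀) / 2 - inner ℝ b (x - x₀)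

lemma quadraticObjective_add_add {A : H →L[ℝ] H} (hA : A.IsSymmetric) (b x₀ x d : H) :
    quadraticObjective A b x₀ (x + d) =
      quadraticObjective A b x₀ x + inner ℝ (A (x - x₀) - b) d + inner ℝ (A d) d / 2 := by
  have hcross : inner ℝ (A d) (x - x₀) = inner ℝ (A (x - x₀)) d := by
    rw [hA.apply_clm, real_inner_comm]
  simp only [quadraticObjective, add_sub_right_comm, map_add, inner_add_left, inner_add_right,
    inner_sub_left _ b, hcross]
  ring

lemma hasGradientAt_quadraticObjective [CompleteSpace H] {A : H →L[ℝ] H} (hA : A.IsSymmetric)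
    (b x₀ x : H) : HasGradientAt (quadraticObjective A b x₀) (A (x - x₀) - b) x := by
  have hsub : HasFDerivAt (fun x => x - x₀) (.id ℝ H) x := (hasFDerivAt_id x).sub_const x₀
  have hquad := (hA.hasStrictFDerivAt_reApplyInnerSelf (x - x₀)).hasFDerivAt.comp x hsub
  have hlin := (innerSL ℝ b).hasFDerivAt.comp x hsub
  rw [hasGradientAt_iff_hasFDerivAt]
  refine ((hquad.mul_const (1 / 2 : ℝ)).sub hlin).congr_fderiv ?_ |>.congr_of_eventuallyEq
    (.of_forall fun y => ?_)
  · ext v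
    simp [-map_sub, inner_sub_left]
  · simp [quadraticObjective, ContinuousLinearMap.reApplyInnerSelf, div_eq_mul_inv, -map_sub]

end QuadraticObjective

lemma isLSmooth_quadraticObjective {A : Ell2 →L[ℝ] Ell2} (hA : A.IsSymmetric) {L : ℝ}
    (hL : ‖A‖ ≤ L) (b x₀ : Ell2) : IsLSmooth L (quadraticObjective A b x₀) := by
  refine ⟨fun x => (hasGradientAt_quadraticObjective hA b x₀ x).differentiableAt, fun x y => ?_⟩
  rw [(hasGradientAt_quadraticObjective hA b x₀ x).gradient,
    (hasGradientAt_quadraticObjective hA b x₀ y).gradient, sub_sub_sub_cancel_right, ← map_sub,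
    sub_sub_sub_cancel_right]
  exact A.le_of_opNorm_le hL _

lemma isMuStronglyConvex_quadraticObjective {A : Ell2 →L[ℝ] Ell2} (hA : A.IsSymmetric) {μ : ℝ}
    (hμ : ∀ x, μ * ‖x‖ ^ 2 ≤ inner ℝ (A x) x) (b x₀ : Ell2) :
    IsMuStronglyConvex μ (quadraticObjective A b x₀) := by
  refine ⟨fun x => (hasGradientAt_quadraticObjective hA b x₀ x).differentiableAt, fun x y => ?_⟩
  have hexpand := quadraticObjective_add_add hA b x₀ x (y - x)
  rw [add_sub_cancel] at hexpand
  rw [(hasGradientAt_quadraticObjective hA b x₀ x).gradient, hexpand]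
  linarith [hμ (y - x)]

lemma fenchelConjugate_quadraticObjective {A R : Ell2 →L[ℝ] Ell2} (hA : A.IsPositive)
    (hAR : A * R = 1) (b x₀ : Ell2) :
    fenchelConjugate (quadraticObjective A b x₀) =
      fun y => quadraticObjective R (-x₀) (-b) y - inner ℝ b x₀ := by
  funext y
  set z := R (y + b) with hz
  have hAz : A z = y + b := DFunLike.congr_fun hAR (y + b)
  have hcomplete (d : Ell2) : inner ℝ y (x₀ + z + d) - quadraticObjective A b x₀ (x₀ + z + d) =
      quadraticObjective R (-x₀) (-b) y - inner ℝ b x₀ - inner ℝ (A d) d / 2 := by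
    rw [quadraticObjective_add_add hA.isSymmetric]
    simp only [quadraticObjective, add_sub_cancel_left, add_sub_cancel_right, sub_neg_eq_add,
      ← hz, hAz, inner_add_left, inner_add_right, inner_neg_left, real_inner_comm y z,
      real_inner_comm b z, real_inner_comm x₀ y, real_inner_comm x₀ b]
    ring
  refine IsLUB.ciSup_eq (IsGreatest.isLUB ⟨⟨x₀ + z, by simpa using hcomplete 0⟩, ?_⟩)
  rintro _ ⟨x, rfl⟩
  have hx := hcomplete (x - (x₀ + z))
  rw [add_sub_cancel] at hx
  linarith [hA.inner_nonneg_left (x - (x₀ + z))]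

lemma gradient_fenchelConjugate_quadraticObjective {A R : Ell2 →L[ℝ] Ell2} (hA : A.IsPositive)
    (hR : R.IsSymmetric) (hAR : A * R = 1) (b x₀ y : Ell2) :
    gradient (fenchelConjugate (quadraticObjective A b x₀)) y = R (y + b) + x₀ := by
  have hgrad := hasGradientAt_quadraticObjective hR (-x₀) (-b) y
  rw [hasGradientAt_iff_hasFDerivAt] at hgrad
  rw [fenchelConjugate_quadraticObjective hA hAR,
    (hasGradientAt_iff_hasFDerivAt.2 (hgrad.sub_const (inner ℝ b x₀))).gradient, sub_neg_eq_add,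
    sub_neg_eq_add]

section ShiftedProjection

variable {H : Type*} [NormedAddCommGroup H] [InnerProductSpace ℝ H] {P : H →L[ℝ] H} {μ g : ℝ}

/-- The operator `μ + g P`; for a projection `P`, the Hessian of an objective with curvature
`μ + g` along the range of `P` and `μ` across it. -/
noncomputable def shiftedProjection (P : H →L[ℝ] H) (μ g : ℝ) : H →L[ℝ] H :=
  μ • 1 + g • P

lemma shiftedProjection_apply (P : H →L[ℝ] H) (μ g : ℝ) (x : H) :
    shiftedProjection P μ g x = μ • x + g • P x := rfl

lemma shiftedProjection_mul_inverse (hP : IsIdempotentElem P) (hμ : μ ≠ 0) (hμg : μ + g ≠ 0) :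
    shiftedProjection P μ g * shiftedProjection P μ⁻¹ ((μ + g)⁻¹ - μ⁻¹) = 1 := by
  simp only [shiftedProjection, add_mul, mul_add, smul_mul_smul_comm, hP.eq, one_mul, mul_one]
  match_scalars
  · field_simp
  · field_simp
    ring

lemma shiftedProjection_mem {V : Submodule ℝ H} {x : H} (hx : x ∈ V) (hPx : P x ∈ V) (μ g : ℝ) :
    shiftedProjection P μ g x ∈ V :=
  V.add_mem (V.smul_mem _ hx) (V.smul_mem _ hPx)

variable [CompleteSpace H]

lemma shiftedProjection_isSymmetric (hP : IsStarProjection P) (μ g : ℝ) :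
    (shiftedProjection P μ g).IsSymmetric :=
  (((IsSelfAdjoint.all μ).smul (.one _)).add
    ((IsSelfAdjoint.all g).smul hP.isSelfAdjoint)).isSymmetric

lemma norm_shiftedProjection_le (hP : IsStarProjection P) (hμ : 0 ≤ μ) (hg : 0 ≤ g) :
    ‖shiftedProjection P μ g‖ ≤ μ + g := by
  refine (norm_add_le _ _).trans (add_le_add ?_ ?_)
  · rw [norm_smul, Real.norm_of_nonneg hμ]
    exact mul_le_of_le_one_right hμ ContinuousLinearMap.norm_id_le
  · rw [norm_smul, Real.norm_of_nonneg hg]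
    exact mul_le_of_le_one_right hg hP.norm_le

lemma le_inner_shiftedProjection (hP : IsStarProjection P) (μ : ℝ) (hg : 0 ≤ g) (x : H) :
    μ * ‖x‖ ^ 2 ≤ inner ℝ (shiftedProjection P μ g x) x := by
  rw [shiftedProjection_apply, inner_add_left, real_inner_smul_left, real_inner_smul_left,
    real_inner_self_eq_norm_sq]
  exact le_add_of_nonneg_right
    (mul_nonneg hg ((ContinuousLinearMap.IsPositive.of_isStarProjection hP).inner_nonneg_left x))

lemma shiftedProjection_isPositive (hP : IsStarProjection P) (hμ : 0 ≤ μ) (hg : 0 ≤ g) :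
    (shiftedProjection P μ g).IsPositive :=
  (ContinuousLinearMap.isPositive_iff _).2 ⟨shiftedProjection_isSymmetric hP μ g, fun x =>
    (mul_nonneg hμ (sq_nonneg _)).trans (le_inner_shiftedProjection hP μ hg x)⟩

end ShiftedProjection

section OrthonormalSequence

variable {H : Type*} [NormedAddCommGroup H] [InnerProductSpace ℝ H]

lemma not_finiteDimensional_orthogonal_span_singleton (hH : ¬ FiniteDimensional ℝ H) (x₀ : H) :
    ¬ FiniteDimensional ℝ (ℝ ∙ x₀)ᗮ := by
  intro hfin
  have hsup : FiniteDimensional ℝ ((ℝ ∙ x₀) ⊔ (ℝ ∙ x₀)ᗮ : Submodule ℝ H) := inferInstance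
  rw [Submodule.sup_orthogonal_of_hasOrthogonalProjection] at hsup
  exact hH (Module.finite_def.2 (Module.Finite.iff_fg.1 hsup))

variable [CompleteSpace H]

lemma exists_orthonormal_sequence (hH : ¬ FiniteDimensional ℝ H) :
    ∃ e : ℕ → H, Orthonormal ℝ e := by
  obtain ⟨w, b, -⟩ := exists_hilbertBasis ℝ H
  have hw : Infinite w := by
    by_contra hfin
    rw [not_infinite_iff_finite] at hfin
    have := Fintype.ofFinite w
    exact hH b.toOrthonormalBasis.toBasis.finiteDimensional_of_finite
  exact ⟨b ∘ Infinite.natEmbedding w, b.orthonormal.comp _ (Infinite.natEmbedding w).injective⟩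

lemma exists_orthonormal_sequence_orthogonal (hH : ¬ FiniteDimensional ℝ H) (x₀ : H) :
    ∃ e : ℕ → H, Orthonormal ℝ e ∧ ∀ i, inner ℝ (e i) x₀ = 0 := by
  obtain ⟨e, he⟩ :=
    exists_orthonormal_sequence (not_finiteDimensional_orthogonal_span_singleton hH x₀)
  exact ⟨fun i => e i, he.comp_linearIsometry (ℝ ∙ x₀)ᗮ.subtypeₗᵢ,
    fun i => Submodule.mem_orthogonal_singleton_iff_inner_left.1 (e i).2⟩

end OrthonormalSequence

lemma not_finiteDimensional_ell2 : ¬ FiniteDimensional ℝ Ell2 := by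
  intro hfin
  have hstd : Orthonormal ℝ fun i : ℕ => (lp.single 2 i (1 : ℝ) : Ell2) := by
    rw [orthonormal_iff_ite]
    intro i j
    rw [lp.inner_single_left, lp.single_apply]
    simp [Pi.single_apply]
  exact hstd.linearIndependent.finite.false

section LinkProjection

variable {H : Type*} [NormedAddCommGroup H] [InnerProductSpace ℝ H] [CompleteSpace H]
  {e : ℕ → H} {x₀ : H}

/-- The orthogonal projection onto the closed span of the differences `e i - e (i + 1)` over
`i = r, r + 2, r + 4, …`. Half the Laplacian of the path `0 — 1 — 2 — ⋯` is the sum of the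
projections for `r = 0` and `r = 1`, each of which couples only disjoint pairs of indices. -/
noncomputable def linkProjection (e : ℕ → H) (r : ℕ) : H →L[ℝ] H :=
  (Submodule.span ℝ
    (range fun k => e (2 * k + r) - e (2 * k + r + 1))).topologicalClosure.starProjection

lemma linkProjection_isStarProjection (e : ℕ → H) (r : ℕ) :
    IsStarProjection (linkProjection e r) :=
  isStarProjection_starProjection

lemma linkProjection_link (e : ℕ → H) (r k : ℕ) :
    linkProjection e r (e (2 * k + r) - e (2 * k + r + 1)) =
      e (2 * k + r) - e (2 * k + r + 1) :=
  Submodule.starProjection_eq_self_iff.2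
    (Submodule.le_topologicalClosure _ (Submodule.subset_span ⟨k, rfl⟩))

lemma linkProjection_eq_zero {r : ℕ} {x : H}
    (hx : ∀ k, inner ℝ (e (2 * k + r) - e (2 * k + r + 1)) x = 0) : linkProjection e r x = 0 := by
  refine Submodule.eq_starProjection_of_mem_orthogonal (Submodule.zero_mem _) ?_
  rw [Submodule.orthogonal_closure, sub_zero, Submodule.mem_orthogonal]
  have hspan : Submodule.span ℝ (range fun k => e (2 * k + r) - e (2 * k + r + 1)) ≤ (ℝ ∙ x)ᗮ :=
    Submodule.span_le.2 (range_subset_iff.2 fun k =>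
      Submodule.mem_orthogonal_singleton_iff_inner_left.2 (hx k))
  exact fun y hy => Submodule.mem_orthogonal_singleton_iff_inner_left.1 (hspan hy)

lemma linkProjection_of_orthogonal (r : ℕ) (h₀ : ∀ i, inner ℝ (e i) x₀ = 0) :
    linkProjection e r x₀ = 0 :=
  linkProjection_eq_zero fun k => by rw [inner_sub_left, h₀, h₀, sub_zero]

lemma linkProjection_of_lt (he : Orthonormal ℝ e) {i r : ℕ} (hi : i < r) :
    linkProjection e r (e i) = 0 :=
  linkProjection_eq_zero fun k => by
    rw [inner_sub_left, he.2 (by lia), he.2 (by lia), sub_zero]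

lemma linkProjection_left (he : Orthonormal ℝ e) (r k : ℕ) :
    linkProjection e r (e (2 * k + r)) = (1 / 2 : ℝ) • (e (2 * k + r) - e (2 * k + r + 1)) := by
  have hsum : linkProjection e r (e (2 * k + r) + e (2 * k + r + 1)) = 0 :=
    linkProjection_eq_zero fun j => by
      simp only [inner_sub_left, inner_add_right, orthonormal_iff_ite.1 he]
      grind
  have hdiff := linkProjection_link e r k
  rw [map_add] at hsum
  rw [map_sub] at hdiff
  rw [← hdiff, eq_neg_of_add_eq_zero_right hsum]
  module

lemma linkProjection_right (he : Orthonormal ℝ e) (r k : ℕ) :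
    linkProjection e r (e (2 * k + r + 1)) =
      (1 / 2 : ℝ) • (e (2 * k + r + 1) - e (2 * k + r)) := by
  have hdiff := linkProjection_link e r k
  rw [map_sub, linkProjection_left he, sub_eq_iff_eq_add', ← sub_eq_iff_eq_add] at hdiff
  rw [← hdiff]
  module

lemma linkProjection_one_add_zero_apply_zero (he : Orthonormal ℝ e) :
    (linkProjection e 1 + linkProjection e 0) (e 0) = (1 / 2 : ℝ) • (e 0 - e 1) := by
  rw [add_apply, linkProjection_of_lt he one_pos, zero_add]
  exact linkProjection_left he 0 0

lemma linkProjection_one_add_zero_apply_succ (he : Orthonormal ℝ e) (i : ℕ) :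
    (linkProjection e 1 + linkProjection e 0) (e (i + 1)) =
      e (i + 1) - (1 / 2 : ℝ) • e i - (1 / 2 : ℝ) • e (i + 2) := by
  rw [add_apply]
  obtain ⟨k, rfl | rfl⟩ := Nat.even_or_odd' i
  · rw [linkProjection_left he 1 k]
    have hright := linkProjection_right he 0 k
    rw [add_zero] at hright
    rw [hright]
    module
  · rw [linkProjection_right he 1 k]
    have hleft := linkProjection_left he 0 (k + 1)
    rw [show 2 * (k + 1) + 0 = 2 * k + 1 + 1 by lia] at hleft
    rw [hleft]
    module

end LinkProjection

section Krylov

variable {H : Type*} [NormedAddCommGroup H] [InnerProductSpace ℝ H] {e : ℕ → H} {x₀ : H}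

/-- The span of `x₀` and the first `m` vectors of `e`: what a node can know after `m` links of the
chain have been discovered. -/
def krylov (e : ℕ → H) (x₀ : H) (m : ℕ) : Submodule ℝ H :=
  Submodule.span ℝ (insert x₀ (e '' Iio m))

lemma krylov_mono (e : ℕ → H) (x₀ : H) : Monotone (krylov e x₀) := fun _ _ h =>
  Submodule.span_mono (insert_subset_insert (image_mono (Iio_subset_Iio h)))

lemma start_mem_krylov (e : ℕ → H) (x₀ : H) (m : ℕ) : x₀ ∈ krylov e x₀ m :=
  Submodule.subset_span (mem_insert _ _)

lemma mem_krylov_of_lt {i m : ℕ} (h : i < m) : e i ∈ krylov e x₀ m :=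
  Submodule.subset_span (mem_insert_of_mem _ ⟨i, h, rfl⟩)

lemma inner_eq_zero_of_mem_krylov (he : Orthonormal ℝ e) (h₀ : ∀ i, inner ℝ (e i) x₀ = 0)
    {m j : ℕ} (hj : m ≤ j) {x : H} (hx : x ∈ krylov e x₀ m) : inner ℝ (e j) x = 0 := by
  have hle : krylov e x₀ m ≤ (ℝ ∙ e j)ᗮ := by
    refine Submodule.span_le.2 (insert_subset ?_ (image_subset_iff.2 fun i hi => ?_))
    · exact Submodule.mem_orthogonal_singleton_iff_inner_right.2 (h₀ j)
    · exact Submodule.mem_orthogonal_singleton_iff_inner_right.2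
        (he.2 (ne_of_gt (lt_of_lt_of_le hi hj)))
  exact Submodule.mem_orthogonal_singleton_iff_inner_right.1 (hle hx)

lemma linkProjection_mem_krylov_of_even [CompleteSpace H] (he : Orthonormal ℝ e)
    (h₀ : ∀ i, inner ℝ (e i) x₀ = 0) {r m : ℕ} (hrm : Even (m + r)) {x : H}
    (hx : x ∈ krylov e x₀ m) : linkProjection e r x ∈ krylov e x₀ m := by
  have hle : krylov e x₀ m ≤ (krylov e x₀ m).comap (linkProjection e r).toLinearMap := by
    refine Submodule.span_le.2 (insert_subset ?_ (image_subset_iff.2 fun i (hi : i < m) => ?_))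
    · simp [linkProjection_of_orthogonal r h₀]
    change linkProjection e r (e i) ∈ krylov e x₀ m
    rcases lt_or_ge i r with hir | hir
    · simp [linkProjection_of_lt he hir]
    obtain ⟨k, hk | hk⟩ := Nat.even_or_odd' (i - r)
    · obtain rfl : i = 2 * k + r := by lia
      rw [linkProjection_left he]
      exact Submodule.smul_mem _ _
        (Submodule.sub_mem _ (mem_krylov_of_lt hi) (mem_krylov_of_lt (by grind)))
    · obtain rfl : i = 2 * k + r + 1 := by lia
      rw [linkProjection_right he]
      exact Submodule.smul_mem _ _
        (Submodule.sub_mem _ (mem_krylov_of_lt hi) (mem_krylov_of_lt (by lia)))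
  exact hle hx

lemma linkProjection_mem_krylov_succ [CompleteSpace H] (he : Orthonormal ℝ e)
    (h₀ : ∀ i, inner ℝ (e i) x₀ = 0) (r : ℕ) {m : ℕ} {x : H} (hx : x ∈ krylov e x₀ m) :
    linkProjection e r x ∈ krylov e x₀ (m + 1) := by
  rcases Nat.even_or_odd (m + r) with hrm | hrm
  · exact krylov_mono e x₀ m.le_succ (linkProjection_mem_krylov_of_even he h₀ hrm hx)
  · exact linkProjection_mem_krylov_of_even he h₀ (by grind) (krylov_mono e x₀ m.le_succ hx)

end Krylov

section GeometricVector

variable {H : Type*} [NormedAddCommGroup H] [InnerProductSpace ℝ H] {e : ℕ → H} {q : ℝ}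

/-- The vector `∑ qⁱ eᵢ`, the displacement of the minimizer of the chain from the starting
point. -/
noncomputable def geometricVector (e : ℕ → H) (q : ℝ) : H := ∑' i, q ^ i • e i

lemma orthonormal_add_right (he : Orthonormal ℝ e) (m : ℕ) : Orthonormal ℝ fun i => e (i + m) :=
  he.comp _ (add_left_injective m)

variable [CompleteSpace H]

lemma hasSum_geometricVector (he : Orthonormal ℝ e) (h0 : 0 ≤ q) (h1 : q < 1) :
    HasSum (fun i => q ^ i • e i) (geometricVector e q) := by
  refine (Summable.of_norm ?_).hasSum
  simpa [norm_smul, he.1, abs_of_nonneg h0] using summable_geometric_of_lt_one h0 h1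

lemma inner_geometricVector (he : Orthonormal ℝ e) (h0 : 0 ≤ q) (h1 : q < 1) (i : ℕ) :
    inner ℝ (e i) (geometricVector e q) = q ^ i := by
  refine ((hasSum_geometricVector he h0 h1).mapL (innerSL ℝ (e i))).unique ?_
  simp only [innerSL_apply_apply, real_inner_smul_right, orthonormal_iff_ite.1 he, mul_ite,
    mul_one, mul_zero, eq_comm (a := i)]
  exact (hasSum_ite_eq i (q ^ i)).congr_fun (by grind)

lemma norm_sq_geometricVector (he : Orthonormal ℝ e) (h0 : 0 ≤ q) (h1 : q < 1) :
    ‖geometricVector e q‖ ^ 2 = (1 - q ^ 2)⁻¹ := by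
  rw [← real_inner_self_eq_norm_sq]
  refine ((hasSum_geometricVector he h0 h1).mapL (innerSL ℝ (geometricVector e q))).unique ?_
  simp only [innerSL_apply_apply, real_inner_smul_right, real_inner_comm (e _),
    inner_geometricVector he h0 h1, ← sq, pow_right_comm q _ 2]
  exact hasSum_geometric_of_lt_one (sq_nonneg q) (by nlinarith)

lemma geometricVector_ne_zero (he : Orthonormal ℝ e) (h0 : 0 ≤ q) (h1 : q < 1) :
    geometricVector e q ≠ 0 := by
  intro hzero
  have hcoord := inner_geometricVector he h0 h1 0
  simp [hzero] at hcoord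

lemma geometricVector_eq_add_shift (he : Orthonormal ℝ e) (h0 : 0 ≤ q) (h1 : q < 1) :
    geometricVector e q = e 0 + q • geometricVector (fun i => e (i + 1)) q := by
  have hshift := hasSum_geometricVector (orthonormal_add_right he 1) h0 h1
  rw [geometricVector, (hasSum_geometricVector he h0 h1).summable.tsum_eq_zero_add, pow_zero,
    one_smul, ← (hshift.const_smul q).tsum_eq]
  simp only [smul_smul, pow_succ']

/-- Bessel's inequality over the coordinates `i ≥ m`, which `x - x₀` does not have. -/
lemma norm_sub_geometricVector_ge (he : Orthonormal ℝ e) {x₀ : H}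
    (h₀ : ∀ i, inner ℝ (e i) x₀ = 0) (h0 : 0 ≤ q) (h1 : q < 1) {m : ℕ} {x : H}
    (hx : x ∈ krylov e x₀ m) :
    q ^ (2 * m) * ‖geometricVector e q‖ ^ 2 ≤ ‖x - (x₀ + geometricVector e q)‖ ^ 2 := by
  have hcoord (i : ℕ) : inner ℝ (e (i + m)) (x - (x₀ + geometricVector e q)) = -q ^ (i + m) := by
    rw [inner_sub_right, inner_add_right, h₀, inner_geometricVector he h0 h1,
      inner_eq_zero_of_mem_krylov he h₀ (Nat.le_add_left m i) hx]
    ring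
  have hbessel := (orthonormal_add_right he m).tsum_inner_products_le
    (x := x - (x₀ + geometricVector e q))
  calc q ^ (2 * m) * ‖geometricVector e q‖ ^ 2
      = ∑' i : ℕ, q ^ (2 * m) * (q ^ 2) ^ i := by
        rw [tsum_mul_left, tsum_geometric_of_lt_one (sq_nonneg q) (by nlinarith),
          norm_sq_geometricVector he h0 h1]
    _ = ∑' i : ℕ, ‖(inner ℝ (e (i + m)) (x - (x₀ + geometricVector e q)) : ℝ)‖ ^ 2 := by
        refine tsum_congr fun i => ?_
        rw [hcoord, norm_neg, Real.norm_of_nonneg (by positivity)]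
        ring
    _ ≤ ‖x - (x₀ + geometricVector e q)‖ ^ 2 := hbessel

lemma linkProjection_geometricVector_shift (he : Orthonormal ℝ e) (h0 : 0 ≤ q) (h1 : q < 1) :
    (linkProjection e 1 + linkProjection e 0) (geometricVector (fun i => e (i + 1)) q) =
      geometricVector (fun i => e (i + 1)) q - (1 / 2 : ℝ) • geometricVector e q
        - (1 / 2 : ℝ) • geometricVector (fun i => e (i + 2)) q := by
  have hshift := hasSum_geometricVector (orthonormal_add_right he 1) h0 h1
  refine (hshift.mapL (linkProjection e 1 + linkProjection e 0)).unique ?_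
  convert (hshift.sub ((hasSum_geometricVector he h0 h1).const_smul (1 / 2 : ℝ))).sub
    ((hasSum_geometricVector (orthonormal_add_right he 2) h0 h1).const_smul (1 / 2 : ℝ))
    using 2 with i
  rw [map_smul, linkProjection_one_add_zero_apply_succ he]
  module

lemma linkProjection_geometricVector (he : Orthonormal ℝ e) (h0 : 0 ≤ q) (h1 : q < 1) :
    (2 * q) • (linkProjection e 1 + linkProjection e 0) (geometricVector e q) =
      (1 - q) • e 0 - (1 - q) ^ 2 • geometricVector e q := by
  have hy := geometricVector_eq_add_shift he h0 h1
  have hz := geometricVector_eq_add_shift (orthonormal_add_right he 1) h0 h1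
  have hDz := linkProjection_geometricVector_shift he h0 h1
  set y := geometricVector e q
  set z := geometricVector (fun i => e (i + 1)) q
  have he0 : e 0 = y - q • z := eq_sub_of_add_eq hy.symm
  have he1 : e 1 = z - q • geometricVector (fun i => e (i + 2)) q := eq_sub_of_add_eq hz.symm
  have hDy : (linkProjection e 1 + linkProjection e 0) y =
      (1 / 2 : ℝ) • (e 0 - e 1) + q • (linkProjection e 1 + linkProjection e 0) z := by
    conv_lhs => rw [hy]
    rw [map_add, map_smul, linkProjection_one_add_zero_apply_zero he]
  rw [hDy, hDz, he1, he0]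
  module

lemma chain_stationary (he : Orthonormal ℝ e) (h0 : 0 < q) (h1 : q < 1) {μ c : ℝ}
    (hc : c * (1 - q) ^ 2 = μ * q) :
    μ • geometricVector e q +
        (2 * c) • (linkProjection e 1 + linkProjection e 0) (geometricVector e q) =
      (μ + c * (1 - q)) • e 0 := by
  refine smul_right_injective _ h0.ne' ?_
  linear_combination (norm := module)
    c • linkProjection_geometricVector he h0.le h1 + hc • (e 0 - geometricVector e q)

end GeometricVector

section Rayleigh

open Matrix

variable {ι : Type*} [Fintype ι]

lemma mem_spectrum_iff_exists_mulVec [DecidableEq ι] {W : Matrix ι ι ℝ} {t : ℝ} :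
    t ∈ spectrum ℝ W ↔ ∃ x, x ≠ 0 ∧ W *ᵥ x = t • x := by
  rw [← Matrix.spectrum_toLin', ← Module.End.hasEigenvalue_iff_mem_spectrum]
  refine ⟨fun h => ?_, fun ⟨x, hx, hWx⟩ =>
    Module.End.hasEigenvalue_of_hasEigenvector (x := x)
      ⟨Module.End.mem_eigenspace_iff.2 hWx, hx⟩⟩
  obtain ⟨x, hx⟩ := h.exists_hasEigenvector
  exact ⟨x, hx.2, hx.apply_eq_smul⟩

/-- The minimum of the quadratic form of `W` over the unit vectors of `S`, i.e. the least
eigenvalue of `W` on `S` when `W` is symmetric and maps `S` into itself. -/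
noncomputable def minRayleigh (W : Matrix ι ι ℝ) (S : Submodule ℝ (ι → ℝ)) : ℝ :=
  sInf ((fun x => x ⬝ᵥ W *ᵥ x) '' {x | x ∈ S ∧ x ⬝ᵥ x = 1})

lemma isCompact_unitSphere (S : Submodule ℝ (ι → ℝ)) : IsCompact {x | x ∈ S ∧ x ⬝ᵥ x = 1} := by
  refine (isCompact_Icc (a := (-1 : ι → ℝ)) (b := 1)).of_isClosed_subset
    (S.closed_of_finiteDimensional.inter (isClosed_eq (by fun_prop) continuous_const))
    fun x ⟨_, hx⟩ => ?_
  have hcoord (i : ι) : |x i| ≤ 1 := by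
    rw [← sq_le_one_iff_abs_le_one, ← hx, sq]
    exact Finset.single_le_sum (f := fun j => x j * x j) (fun j _ => mul_self_nonneg _)
      (Finset.mem_univ i)
  exact ⟨fun i => (abs_le.1 (hcoord i)).1, fun i => (abs_le.1 (hcoord i)).2⟩

lemma dotProduct_self_pos {x : ι → ℝ} (hx : x ≠ 0) : 0 < x ⬝ᵥ x := by
  simpa using dotProduct_self_star_pos_iff.2 hx

lemma exists_smul_unit {S : Submodule ℝ (ι → ℝ)} {x : ι → ℝ} (hx : x ∈ S) (hx0 : x ≠ 0) :
    ∃ s : ℝ, ∃ y ∈ S, y ⬝ᵥ y = 1 ∧ x = s • y := by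
  have hpos := dotProduct_self_pos hx0
  have hsqrt := Real.sqrt_ne_zero'.2 hpos
  refine ⟨√(x ⬝ᵥ x), (√(x ⬝ᵥ x))⁻¹ • x, S.smul_mem _ hx, ?_, ?_⟩
  · rw [smul_dotProduct, dotProduct_smul, smul_eq_mul, smul_eq_mul]
    field_simp
    exact (Real.sq_sqrt hpos.le).symm
  · rw [smul_smul, mul_inv_cancel₀ hsqrt, one_smul]

lemma minRayleigh_mul_le (W : Matrix ι ι ℝ) {S : Submodule ℝ (ι → ℝ)} {x : ι → ℝ} (hx : x ∈ S) :
    minRayleigh W S * (x ⬝ᵥ x) ≤ x ⬝ᵥ W *ᵥ x := by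
  rcases eq_or_ne x 0 with rfl | hx0
  · simp
  obtain ⟨s, y, hyS, hy, rfl⟩ := exists_smul_unit hx hx0
  have hmin : minRayleigh W S ≤ y ⬝ᵥ W *ᵥ y :=
    csInf_le ((isCompact_unitSphere S).image (by fun_prop)).bddBelow ⟨y, ⟨hyS, hy⟩, rfl⟩
  simp only [mulVec_smul, smul_dotProduct, dotProduct_smul, hy, smul_eq_mul]
  nlinarith [mul_le_mul_of_nonneg_left hmin (mul_self_nonneg s)]

lemma exists_eq_minRayleigh (W : Matrix ι ι ℝ) {S : Submodule ℝ (ι → ℝ)} (hS : S ≠ ⊥) :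
    ∃ x ∈ S, x ⬝ᵥ x = 1 ∧ x ⬝ᵥ W *ᵥ x = minRayleigh W S := by
  obtain ⟨z, hzS, hz0⟩ := S.exists_mem_ne_zero_of_ne_bot hS
  obtain ⟨-, y, hyS, hy, -⟩ := exists_smul_unit hzS hz0
  obtain ⟨x, ⟨hxS, hx⟩, hmin⟩ := ((isCompact_unitSphere S).image (f := fun x => x ⬝ᵥ W *ᵥ x)
    (by fun_prop)).sInf_mem ⟨_, y, ⟨hyS, hy⟩, rfl⟩
  exact ⟨x, hxS, hx, hmin⟩

lemma le_minRayleigh {W : Matrix ι ι ℝ} {S : Submodule ℝ (ι → ℝ)} (hS : S ≠ ⊥) {c : ℝ}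
    (hc : ∀ x ∈ S, c * (x ⬝ᵥ x) ≤ x ⬝ᵥ W *ᵥ x) : c ≤ minRayleigh W S := by
  obtain ⟨x, hxS, hx, hmin⟩ := exists_eq_minRayleigh W hS
  simpa [hx, hmin] using hc x hxS

lemma continuous_minRayleigh (S : Submodule ℝ (ι → ℝ)) :
    Continuous fun W : Matrix ι ι ℝ => minRayleigh W S :=
  (isCompact_unitSphere S).continuous_sInf
    (f := fun (W : Matrix ι ι ℝ) (x : ι → ℝ) => x ⬝ᵥ W *ᵥ x) (by fun_prop)

lemma dotProduct_mulVec_symm {W : Matrix ι ι ℝ} (hW : W.IsSymm) (x y : ι → ℝ) :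
    x ⬝ᵥ W *ᵥ y = y ⬝ᵥ W *ᵥ x := by
  rw [dotProduct_mulVec, ← mulVec_transpose, hW.eq, dotProduct_comm]

/-- First variation of the form `⟨x, W x⟩ - t ⟨x, x⟩` in the direction of its own gradient. -/
lemma mulVec_eq_smul_of_isMin {W : Matrix ι ι ℝ} (hW : W.IsSymm) {S : Submodule ℝ (ι → ℝ)}
    (hWS : ∀ x ∈ S, W *ᵥ x ∈ S) {t : ℝ} (ht : ∀ x ∈ S, t * (x ⬝ᵥ x) ≤ x ⬝ᵥ W *ᵥ x)
    {x : ι → ℝ} (hx : x ∈ S) (hmin : x ⬝ᵥ W *ᵥ x = t * (x ⬝ᵥ x)) : W *ᵥ x = t • x := by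
  set y := W *ᵥ x - t • x with hy
  have hyS : y ∈ S := S.sub_mem (hWS x hx) (S.smul_mem t hx)
  have hyy : y ⬝ᵥ W *ᵥ x - t * (y ⬝ᵥ x) = y ⬝ᵥ y := by
    conv_rhs => rw [hy, dotProduct_sub, dotProduct_smul, smul_eq_mul]
  have hquad (s : ℝ) :
      0 ≤ (y ⬝ᵥ W *ᵥ y - t * (y ⬝ᵥ y)) * (s * s) + 2 * (y ⬝ᵥ y) * s + 0 := by
    have hs := ht (x + s • y) (S.add_mem hx (S.smul_mem s hyS))
    simp only [mulVec_add, mulVec_smul, add_dotProduct, dotProduct_add, smul_dotProduct,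
      dotProduct_smul, smul_eq_mul, hmin, dotProduct_mulVec_symm hW x y,
      dotProduct_comm x y] at hs
    linear_combination hs + 2 * s * hyy
  have hdiscrim := discrim_le_zero hquad
  rw [discrim, mul_zero, sub_zero, sq_nonpos_iff, mul_eq_zero_iff_left two_ne_zero,
    dotProduct_self_eq_zero] at hdiscrim
  exact sub_eq_zero.1 hdiscrim

lemma isLeast_minRayleigh {W : Matrix ι ι ℝ} (hW : W.IsSymm) {S : Submodule ℝ (ι → ℝ)}
    (hWS : ∀ x ∈ S, W *ᵥ x ∈ S) (hS : S ≠ ⊥) :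
    IsLeast {t : ℝ | ∃ x ∈ S, x ≠ 0 ∧ W *ᵥ x = t • x} (minRayleigh W S) := by
  constructor
  · obtain ⟨x, hxS, hx, hmin⟩ := exists_eq_minRayleigh W hS
    refine ⟨x, hxS, ?_, mulVec_eq_smul_of_isMin hW hWS (fun y => minRayleigh_mul_le W) hxS ?_⟩
    · rintro rfl
      simp at hx
    · rw [hmin, hx, mul_one]
  · rintro t ⟨x, hxS, hx0, hx⟩
    have hle := minRayleigh_mul_le W hxS
    rw [hx, dotProduct_smul, smul_eq_mul] at hle
    exact le_of_mul_le_mul_right hle (dotProduct_self_pos hx0)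

/-- The maximum of the quadratic form of `W` over the unit vectors, i.e. the greatest eigenvalue
of a symmetric matrix `W`. -/
noncomputable def maxRayleigh (W : Matrix ι ι ℝ) : ℝ := -minRayleigh (-W) ⊤

lemma dotProduct_mulVec_le_maxRayleigh (W : Matrix ι ι ℝ) (x : ι → ℝ) :
    x ⬝ᵥ W *ᵥ x ≤ maxRayleigh W * (x ⬝ᵥ x) := by
  have hle := minRayleigh_mul_le (-W) (Submodule.mem_top (x := x))
  rw [neg_mulVec, dotProduct_neg] at hle
  rw [maxRayleigh]
  linarith

lemma maxRayleigh_le [Nonempty ι] {W : Matrix ι ι ℝ} {c : ℝ}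
    (hc : ∀ x, x ⬝ᵥ W *ᵥ x ≤ c * (x ⬝ᵥ x)) : maxRayleigh W ≤ c := by
  rw [maxRayleigh, neg_le]
  refine le_minRayleigh top_ne_bot fun x _ => ?_
  rw [neg_mulVec, dotProduct_neg, neg_mul]
  exact neg_le_neg (hc x)

lemma continuous_maxRayleigh : Continuous fun W : Matrix ι ι ℝ => maxRayleigh W :=
  ((continuous_minRayleigh ⊤).comp continuous_neg).neg

lemma isGreatest_maxRayleigh [DecidableEq ι] [Nonempty ι] {W : Matrix ι ι ℝ} (hW : W.IsSymm) :
    IsGreatest (spectrum ℝ W) (maxRayleigh W) := by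
  have hleast := isLeast_minRayleigh hW.neg (fun x _ => Submodule.mem_top) top_ne_bot
  have hneg (t : ℝ) : t ∈ spectrum ℝ W ↔
      -t ∈ {t : ℝ | ∃ x ∈ (⊤ : Submodule ℝ (ι → ℝ)), x ≠ 0 ∧ -W *ᵥ x = t • x} := by
    simp [mem_spectrum_iff_exists_mulVec, neg_mulVec]
  refine ⟨(hneg _).2 (by rw [maxRayleigh, neg_neg]; exact hleast.1), fun t ht => ?_⟩
  exact le_neg_of_le_neg (hleast.2 ((hneg t).1 ht))

end Rayleigh

section Laplacian

open Matrix

variable {n : ℕ} {G : SimpleGraph (Fin n)} {A : Matrix (Fin n) (Fin n) ℝ}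

lemma weightedLaplacian_mulVec_apply (A : Matrix (Fin n) (Fin n) ℝ) (x : Fin n → ℝ) (i : Fin n) :
    (weightedLaplacian A *ᵥ x) i = ∑ j, A i j * (x i - x j) := by
  simp only [weightedLaplacian, sub_mulVec, Pi.sub_apply, mulVec_diagonal, mul_sub,
    Finset.sum_sub_distrib, Finset.sum_mul]
  rfl

lemma weightedLaplacian_mulVec_eq_zero_of_const {x : Fin n → ℝ} (hx : ∀ i j, x i = x j) :
    weightedLaplacian A *ᵥ x = 0 := by
  ext i
  rw [weightedLaplacian_mulVec_apply]
  exact Finset.sum_eq_zero fun j _ => by rw [hx i j, sub_self, mul_zero]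

lemma weightedLaplacian_add_smul (A B : Matrix (Fin n) (Fin n) ℝ) (t : ℝ) :
    weightedLaplacian (A + t • B) = weightedLaplacian A + t • weightedLaplacian B := by
  ext i j
  by_cases hij : i = j <;>
    simp [weightedLaplacian, hij, Finset.sum_add_distrib, ← Finset.mul_sum] <;> ring

lemma weightedLaplacian_isSymm (hA : A.IsSymm) : (weightedLaplacian A).IsSymm :=
  (isSymm_diagonal _).sub hA

/-- The space of vectors with vanishing entry sum, the orthogonal complement of the constant
vectors. -/
def sumZero (n : ℕ) : Submodule ℝ (Fin n → ℝ) := LinearMap.ker (∑ i, LinearMap.proj i)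

lemma mem_sumZero {x : Fin n → ℝ} : x ∈ sumZero n ↔ ∑ i, x i = 0 := by
  simp [sumZero]

lemma single_sub_single_mem_sumZero (c d : Fin n) :
    (Pi.single c 1 - Pi.single d 1 : Fin n → ℝ) ∈ sumZero n := by
  simp [mem_sumZero]

lemma sumZero_ne_bot {c d : Fin n} (hcd : c ≠ d) : sumZero n ≠ ⊥ := by
  refine (Submodule.ne_bot_iff _).2 ⟨_, single_sub_single_mem_sumZero c d, fun h => ?_⟩
  simpa [hcd] using congrFun h c

lemma sub_mean_mem_sumZero (x : Fin n → ℝ) : (fun i => x i - (∑ j, x j) / n) ∈ sumZero n := by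
  rcases eq_or_ne n 0 with rfl | hn
  · simp [mem_sumZero]
  · simp only [mem_sumZero, Finset.sum_sub_distrib, Finset.sum_const, Finset.card_fin,
      nsmul_eq_mul]
    field_simp
    ring

lemma weightedLaplacian_mulVec_mem_sumZero (hA : A.IsSymm) (x : Fin n → ℝ) :
    weightedLaplacian A *ᵥ x ∈ sumZero n := by
  rw [mem_sumZero, ← one_dotProduct, dotProduct_mulVec_symm (weightedLaplacian_isSymm hA),
    weightedLaplacian_mulVec_eq_zero_of_const fun _ _ => rfl, dotProduct_zero]

/-- The quadratic form of the weighted Laplacian. -/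
def dirichletForm (A : Matrix (Fin n) (Fin n) ℝ) (x : Fin n → ℝ) : ℝ :=
  x ⬝ᵥ weightedLaplacian A *ᵥ x

lemma two_mul_dirichletForm (hA : A.IsSymm) (x : Fin n → ℝ) :
    2 * dirichletForm A x = ∑ i, ∑ j, A i j * (x i - x j) ^ 2 := by
  have hrow : dirichletForm A x = ∑ i, ∑ j, x i * (A i j * (x i - x j)) := by
    simp only [dirichletForm, dotProduct, weightedLaplacian_mulVec_apply, Finset.mul_sum]
  have hcol : dirichletForm A x = ∑ i, ∑ j, x j * (A i j * (x j - x i)) := by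
    rw [hrow, Finset.sum_comm]
    simp only [hA.apply]
  rw [two_mul]
  nth_rw 1 [hrow]
  simp only [hcol, ← Finset.sum_add_distrib]
  exact Finset.sum_congr rfl fun i _ => Finset.sum_congr rfl fun j _ => by ring

lemma dirichletForm_add_smul (A B : Matrix (Fin n) (Fin n) ℝ) (t : ℝ) (x : Fin n → ℝ) :
    dirichletForm (A + t • B) x = dirichletForm A x + t * dirichletForm B x := by
  simp only [dirichletForm, weightedLaplacian_add_smul, add_mulVec, smul_mulVec, dotProduct_add,
    dotProduct_smul, smul_eq_mul]

lemma dirichletForm_smul (t : ℝ) (A : Matrix (Fin n) (Fin n) ℝ) (x : Fin n → ℝ) :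
    dirichletForm (t • A) x = t * dirichletForm A x := by
  simpa [dirichletForm, weightedLaplacian] using dirichletForm_add_smul 0 A t x

lemma IsWeightedAdjacency.dirichletForm_nonneg (hA : IsWeightedAdjacency G A) (x : Fin n → ℝ) :
    0 ≤ dirichletForm A x := by
  have hentry (i j : Fin n) : 0 ≤ A i j := by
    by_cases hij : G.Adj i j
    · exact (hA.2.1 i j hij).le
    · exact (hA.2.2 i j hij).ge
  have hsum : 0 ≤ ∑ i, ∑ j, A i j * (x i - x j) ^ 2 :=
    Finset.sum_nonneg fun i _ => Finset.sum_nonneg fun j _ => mul_nonneg (hentry i j) (sq_nonneg _)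
  linarith [two_mul_dirichletForm hA.1 x]

/-- The minimum of the Dirichlet form over the unit vectors orthogonal to the constants; when
positive, it is the smallest positive eigenvalue of the Laplacian. -/
noncomputable def algebraicConnectivity (A : Matrix (Fin n) (Fin n) ℝ) : ℝ :=
  minRayleigh (weightedLaplacian A) (sumZero n)

lemma hasConditionNumber_weightedLaplacian [Nonempty (Fin n)] (hA : A.IsSymm)
    (hn : sumZero n ≠ ⊥) (hpos : 0 < algebraicConnectivity A) :
    HasConditionNumber (weightedLaplacian A)
      (maxRayleigh (weightedLaplacian A) / algebraicConnectivity A) := by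
  have hsymm := weightedLaplacian_isSymm hA
  obtain ⟨⟨x, -, hx0, hx⟩, hmin⟩ := isLeast_minRayleigh hsymm
    (fun x _ => weightedLaplacian_mulVec_mem_sumZero hA x) hn
  refine ⟨_, _, isGreatest_maxRayleigh hsymm,
    ⟨⟨mem_spectrum_iff_exists_mulVec.2 ⟨x, hx0, hx⟩, hpos⟩, fun t ⟨ht, ht0⟩ => ?_⟩, rfl⟩
  obtain ⟨y, hy0, hy⟩ := mem_spectrum_iff_exists_mulVec.1 ht
  have hyS := weightedLaplacian_mulVec_mem_sumZero hA y
  rw [hy, Submodule.smul_mem_iff _ ht0.ne'] at hyS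
  exact hmin ⟨y, hyS, hy0, hy⟩

lemma eq_of_weightedLaplacian_mulVec_eq_zero (hpos : 0 < algebraicConnectivity A)
    {x : Fin n → ℝ} (hx : weightedLaplacian A *ᵥ x = 0) (i j : Fin n) : x i = x j := by
  set y : Fin n → ℝ := fun i => x i - (∑ j, x j) / n with hy
  have hLy : weightedLaplacian A *ᵥ y = 0 := by
    rw [← hx]
    ext i
    simp only [weightedLaplacian_mulVec_apply, hy, sub_sub_sub_cancel_right]
  have hgap := minRayleigh_mul_le (weightedLaplacian A) (sub_mean_mem_sumZero x)
  rw [← hy, hLy, dotProduct_zero] at hgap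
  have hy0 : y = 0 := by
    by_contra hne
    exact hgap.not_gt (mul_pos hpos (dotProduct_self_pos hne))
  exact sub_left_injective ((congrFun hy0 i).trans (congrFun hy0 j).symm)

lemma IsWeightedAdjacency.isGossipMatrix (hA : IsWeightedAdjacency G A)
    (hpos : 0 < algebraicConnectivity A) : IsGossipMatrix G (weightedLaplacian A) := by
  refine ⟨fun i j hij hadj => ?_, fun x => ⟨fun hx => ?_, fun hx => ?_⟩⟩
  · simp [weightedLaplacian, hij, hA.2.2 i j hadj]
  · exact eq_of_weightedLaplacian_mulVec_eq_zero hpos hx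
  · exact weightedLaplacian_mulVec_eq_zero_of_const hx

lemma isWeightedAdjacency_smul_adjMatrix [DecidableRel G.Adj] {α : ℝ} (hα : 0 < α) :
    IsWeightedAdjacency G (α • G.adjMatrix ℝ) :=
  ⟨(G.isSymm_adjMatrix (α := ℝ)).smul α, fun i j hij => by simp [hij, hα],
    fun i j hij => by simp [hij]⟩

lemma IsWeightedAdjacency.add_smul_adjMatrix (hA : IsWeightedAdjacency G A)
    {H : SimpleGraph (Fin n)} [DecidableRel H.Adj] {α : ℝ} (hα : 0 < α) :
    IsWeightedAdjacency (G ⊔ H) (A + α • H.adjMatrix ℝ) := by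
  refine ⟨hA.1.add ((H.isSymm_adjMatrix (α := ℝ)).smul α), fun i j hij => ?_, fun i j hij => ?_⟩
  · by_cases hG : G.Adj i j <;> by_cases hH : H.Adj i j
    · simpa [hH] using add_pos (hA.2.1 i j hG) hα
    · simpa [hH] using hA.2.1 i j hG
    · simpa [hH, hA.2.2 i j hG] using hα
    · exact absurd hij (by simp [hG, hH])
  · rw [SimpleGraph.sup_adj, not_or] at hij
    simp [hA.2.2 i j hij.1, hij.2]

/-- The star with center `a` and set of leaves `S`. -/
def starOn (a : Fin n) (S : Finset (Fin n)) : SimpleGraph (Fin n) :=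
  .fromRel fun i j => i = a ∧ j ∈ S

instance (a : Fin n) (S : Finset (Fin n)) : DecidableRel (starOn a S).Adj :=
  inferInstanceAs (DecidableRel (SimpleGraph.fromRel _).Adj)

lemma starOn_adj {a i j : Fin n} {S : Finset (Fin n)} :
    (starOn a S).Adj i j ↔ i ≠ j ∧ (i = a ∧ j ∈ S ∨ j = a ∧ i ∈ S) := Iff.rfl

lemma starOn_singleton_le {a b : Fin n} (hab : G.Adj a b) : starOn a {b} ≤ G := by
  rintro i j ⟨-, ⟨rfl, hj⟩ | ⟨rfl, hi⟩⟩
  · rwa [Finset.mem_singleton.1 hj]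
  · rw [Finset.mem_singleton.1 hi]
    exact hab.symm

lemma dirichletForm_starOn (a : Fin n) (S : Finset (Fin n)) (x : Fin n → ℝ) :
    dirichletForm ((starOn a S).adjMatrix ℝ) x = ∑ j ∈ S, (x a - x j) ^ 2 := by
  have hentry (i j : Fin n) : (starOn a S).adjMatrix ℝ i j * (x i - x j) ^ 2 =
      (if i = a then if j ∈ S then (x i - x j) ^ 2 else 0 else 0) +
        (if j = a then if i ∈ S then (x i - x j) ^ 2 else 0 else 0) := by
    simp only [SimpleGraph.adjMatrix_apply, starOn_adj]
    split_ifs <;> simp_all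
  have hsum := two_mul_dirichletForm ((starOn a S).isSymm_adjMatrix (α := ℝ)) x
  simp only [hentry, Finset.sum_add_distrib, Finset.sum_ite_irrel, Finset.sum_const_zero,
    Finset.sum_ite_eq', Finset.mem_univ, if_true, Finset.sum_ite_mem, Finset.univ_inter,
    fun j => sub_sq_comm (x j) (x a)] at hsum
  linarith

lemma le_algebraicConnectivity (hn : sumZero n ≠ ⊥) {r : ℝ}
    (hr : ∀ x ∈ sumZero n, r * (x ⬝ᵥ x) ≤ dirichletForm A x) : r ≤ algebraicConnectivity A :=
  le_minRayleigh hn hr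

lemma le_maxRayleigh_add_smul_starOn (hA : IsWeightedAdjacency G A) {a b : Fin n} (hab : a ≠ b)
    (t : ℝ) :
    t ≤ maxRayleigh (weightedLaplacian (A + t • (starOn a {b}).adjMatrix ℝ)) := by
  set x : Fin n → ℝ := Pi.single a 1 with hx
  have hle := dotProduct_mulVec_le_maxRayleigh
    (weightedLaplacian (A + t • (starOn a {b}).adjMatrix ℝ)) x
  rw [← dirichletForm, dirichletForm_add_smul, dirichletForm_starOn] at hle
  have hxx : x ⬝ᵥ x = 1 := by simp [hx]
  have hedge : ∑ j ∈ {b}, (x a - x j) ^ 2 = 1 := by simp [hx, hab.symm]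
  rw [hxx, hedge] at hle
  linarith [hA.dirichletForm_nonneg x]

lemma algebraicConnectivity_add_smul_starOn_le {a b c d : Fin n} (hcd : c ≠ d) (hac : a ≠ c)
    (had : a ≠ d) (hbc : b ≠ c) (hbd : b ≠ d) (t : ℝ) :
    algebraicConnectivity (A + t • (starOn a {b}).adjMatrix ℝ) ≤
      dirichletForm A (Pi.single c 1 - Pi.single d 1) / 2 := by
  set x : Fin n → ℝ := Pi.single c 1 - Pi.single d 1 with hx
  have hle := minRayleigh_mul_le (weightedLaplacian (A + t • (starOn a {b}).adjMatrix ℝ))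
    (single_sub_single_mem_sumZero c d)
  rw [← hx, ← dirichletForm, dirichletForm_add_smul, dirichletForm_starOn,
    ← algebraicConnectivity] at hle
  have hxx : x ⬝ᵥ x = 2 := by simp [hx, hcd, hcd.symm]; norm_num
  have hedge : ∑ j ∈ {b}, (x a - x j) ^ 2 = 0 := by simp [hx, hac, had, hbc, hbd]
  rw [hxx, hedge] at hle
  linarith

/-- Raising the weight of the edge `ab` sends the largest eigenvalue to infinity, while the vector
supported on `c` and `d` keeps the second smallest one bounded. -/
lemma exists_weight_maxRayleigh_eq (hA : IsWeightedAdjacency G A) {χ r : ℝ}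
    (hχ : 0 ≤ χ) (hlow : ∀ x ∈ sumZero n, r * (x ⬝ᵥ x) ≤ dirichletForm A x)
    (hup : ∀ x, dirichletForm A x ≤ χ * r * (x ⬝ᵥ x)) {a b c d : Fin n} (hab : a ≠ b)
    (hcd : c ≠ d) (hac : a ≠ c) (had : a ≠ d) (hbc : b ≠ c) (hbd : b ≠ d) :
    ∃ t : ℝ, 0 ≤ t ∧ maxRayleigh (weightedLaplacian (A + t • (starOn a {b}).adjMatrix ℝ)) =
      χ * algebraicConnectivity (A + t • (starOn a {b}).adjMatrix ℝ) := by
  have : Nonempty (Fin n) := ⟨a⟩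
  set B : ℝ → Matrix (Fin n) (Fin n) ℝ := fun t => A + t • (starOn a {b}).adjMatrix ℝ with hB
  set m := dirichletForm A (Pi.single c 1 - Pi.single d 1) / 2
  have hm0 : 0 ≤ m := div_nonneg (hA.dirichletForm_nonneg _) zero_le_two
  have hcont : Continuous fun t => weightedLaplacian (B t) := by
    simp only [hB, weightedLaplacian_add_smul]
    fun_prop
  have hU : Continuous fun t => maxRayleigh (weightedLaplacian (B t)) :=
    continuous_maxRayleigh.comp hcont
  have hV : Continuous fun t => χ * algebraicConnectivity (B t) :=
    continuous_const.mul ((continuous_minRayleigh _).comp hcont)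
  have hstart : maxRayleigh (weightedLaplacian (B 0)) ≤ χ * algebraicConnectivity (B 0) := by
    have hB0 : B 0 = A := by simp only [hB, zero_smul, add_zero]
    rw [hB0]
    exact (maxRayleigh_le hup).trans
      (mul_le_mul_of_nonneg_left (le_algebraicConnectivity (sumZero_ne_bot hcd) hlow) hχ)
  have hend : χ * algebraicConnectivity (B (χ * m)) ≤ maxRayleigh (weightedLaplacian (B (χ * m))) :=
    (mul_le_mul_of_nonneg_left
      (algebraicConnectivity_add_smul_starOn_le hcd hac had hbc hbd _) hχ).trans
      (le_maxRayleigh_add_smul_starOn hA hab _)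
  obtain ⟨t, ht, heq⟩ := isPreconnected_Icc.intermediate_value₂
    (left_mem_Icc.2 (mul_nonneg hχ hm0)) (right_mem_Icc.2 (mul_nonneg hχ hm0))
    hU.continuousOn hV.continuousOn hstart hend
  exact ⟨t, ht.1, heq⟩

lemma IsWeightedAdjacency.exists_hasConditionNumber (hA : IsWeightedAdjacency G A) {χ r : ℝ}
    (hχ : 0 ≤ χ) (hr : 0 < r) (hlow : ∀ x ∈ sumZero n, r * (x ⬝ᵥ x) ≤ dirichletForm A x)
    (hup : ∀ x, dirichletForm A x ≤ χ * r * (x ⬝ᵥ x)) {a b c d : Fin n} (hab : G.Adj a b)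
    (hcd : c ≠ d) (hac : a ≠ c) (had : a ≠ d) (hbc : b ≠ c) (hbd : b ≠ d) :
    ∃ W, IsWeightedLaplacianOf G W ∧ IsGossipMatrix G W ∧ HasConditionNumber W χ := by
  have : Nonempty (Fin n) := ⟨a⟩
  obtain ⟨t, ht, heq⟩ := exists_weight_maxRayleigh_eq hA hχ hlow hup hab.ne hcd hac had hbc hbd
  set B := A + t • (starOn a {b}).adjMatrix ℝ with hBdef
  have hB : IsWeightedAdjacency G B := by
    rcases ht.eq_or_lt with rfl | ht
    · simpa [hBdef] using hA
    · simpa only [sup_eq_left.2 (starOn_singleton_le hab)] using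
        hA.add_smul_adjMatrix (H := starOn a {b}) ht
  have hedge (x : Fin n → ℝ) : 0 ≤ t * dirichletForm ((starOn a {b}).adjMatrix ℝ) x := by
    rw [dirichletForm_starOn]
    positivity
  have hpos : 0 < algebraicConnectivity B :=
    hr.trans_le (le_algebraicConnectivity (sumZero_ne_bot hcd) fun x hx => by
      rw [dirichletForm_add_smul]
      linarith [hlow x hx, hedge x])
  refine ⟨weightedLaplacian B, ⟨B, hB, rfl⟩, hB.isGossipMatrix hpos, ?_⟩
  have hχB := hasConditionNumber_weightedLaplacian hB.1 (sumZero_ne_bot hcd) hpos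
  rwa [heq, mul_div_cancel_right₀ _ hpos.ne'] at hχB

end Laplacian

section PathPoincare

lemma sum_sub_sq_le {ι : Type*} (S : Finset ι) (x : ι → ℝ) (y : ℝ) :
    ∑ j ∈ S, (y - x j) ^ 2 ≤ (2 * S.card + 1) * (∑ j ∈ S, x j ^ 2 + y ^ 2 / 2) := by
  have hcauchy := sq_sum_le_card_mul_sum_sq (s := S) (f := x)
  have hexpand : ∑ j ∈ S, (y - x j) ^ 2 =
      S.card * y ^ 2 - 2 * y * ∑ j ∈ S, x j + ∑ j ∈ S, x j ^ 2 := by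
    simp only [sub_sq, Finset.sum_add_distrib, Finset.sum_sub_distrib, Finset.sum_const,
      nsmul_eq_mul, Finset.mul_sum]
  linarith [sq_nonneg (2 * ∑ j ∈ S, x j + y)]

lemma sum_sub_sq_eq_add {ι : Type*} {S : Finset ι} (hS : S.Nonempty) (x : ι → ℝ) (y : ℝ) :
    ∑ j ∈ S, (y - x j) ^ 2 = ∑ j ∈ S, ((∑ i ∈ S, x i) / S.card - x j) ^ 2 +
      S.card * (y - (∑ i ∈ S, x i) / S.card) ^ 2 := by
  have hcard : (S.card : ℝ) ≠ 0 := Nat.cast_ne_zero.2 hS.card_ne_zero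
  simp only [sub_sq, Finset.sum_add_distrib, Finset.sum_sub_distrib, Finset.sum_const,
    nsmul_eq_mul, ← Finset.mul_sum]
  field_simp
  ring

/-- Replacing the leaves of a star by their mean reduces the gap estimate to a path. -/
lemma sum_sq_sub_le_of_one_le {ι : Type*} {S : Finset ι} (hS : S.Nonempty) (x : ι → ℝ) (y : ℝ)
    {α : ℝ} (hα : 1 ≤ α) :
    ∑ j ∈ S, x j ^ 2 - S.card * ((∑ j ∈ S, x j) / S.card) ^ 2 ≤
      α * ∑ j ∈ S, (y - x j) ^ 2 -
        α * (S.card * (y - (∑ j ∈ S, x j) / S.card) ^ 2) := by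
  have hvar : 0 ≤ ∑ j ∈ S, ((∑ i ∈ S, x i) / S.card - x j) ^ 2 := by positivity
  have hzero := sum_sub_sq_eq_add hS x 0
  simp only [zero_sub, neg_sq] at hzero
  rw [sum_sub_sq_eq_add hS x y, hzero]
  linarith [le_mul_of_one_le_left hvar hα]

/-- Cauchy–Schwarz along the path, with resistances `1/2, 1, 1, 1/2` on its four edges. -/
lemma sum_pairs_le_sum_path {s t : ℝ} (hs : 0 ≤ s) (ht : 0 ≤ t) (x a b c y : ℝ) :
    s * t * (x - y) ^ 2 + s * ((x - a) ^ 2 + (x - b) ^ 2 + (x - c) ^ 2) +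
        t * ((y - c) ^ 2 + (y - b) ^ 2 + (y - a) ^ 2) +
        (a - b) ^ 2 + (b - c) ^ 2 + (a - c) ^ 2 ≤
      (6 * (s * t) + 9 * s) * (a - x) ^ 2 +
        (3 * (s * t) + 4 * s + 5 / 2 * t + 3) * (b - a) ^ 2 +
        (3 * (s * t) + 5 / 2 * s + 4 * t + 3) * (b - c) ^ 2 +
        (6 * (s * t) + 9 * t) * (c - y) ^ 2 := by
  obtain ⟨d₁, rfl⟩ : ∃ d, x = a - d := ⟨a - x, by ring⟩
  obtain ⟨d₂, rfl⟩ : ∃ d, a = b - d := ⟨b - a, by ring⟩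
  obtain ⟨d₃, rfl⟩ : ∃ d, c = b - d := ⟨b - c, by ring⟩
  obtain ⟨d₄, rfl⟩ : ∃ d, y = b - d₃ - d := ⟨b - d₃ - y, by ring⟩
  have hxy : (d₁ + d₂ - d₃ - d₄) ^ 2 ≤ 6 * d₁ ^ 2 + 3 * d₂ ^ 2 + 3 * d₃ ^ 2 + 6 * d₄ ^ 2 := by
    linarith [sq_nonneg (2 * d₁ - d₂), sq_nonneg (2 * d₁ + d₃), sq_nonneg (d₁ + d₄),
      sq_nonneg (d₂ + d₃), sq_nonneg (d₂ + 2 * d₄), sq_nonneg (d₃ - 2 * d₄)]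
  have hxb : (d₁ + d₂) ^ 2 ≤ 3 * d₁ ^ 2 + 3 / 2 * d₂ ^ 2 := by
    linarith [sq_nonneg (2 * d₁ - d₂)]
  have hxc : (d₁ + d₂ - d₃) ^ 2 ≤ 5 * d₁ ^ 2 + 5 / 2 * d₂ ^ 2 + 5 / 2 * d₃ ^ 2 := by
    linarith [sq_nonneg (2 * d₁ - d₂), sq_nonneg (2 * d₁ + d₃), sq_nonneg (d₂ + d₃)]
  have hyb : (d₃ + d₄) ^ 2 ≤ 3 / 2 * d₃ ^ 2 + 3 * d₄ ^ 2 := by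
    linarith [sq_nonneg (2 * d₄ - d₃)]
  have hya : (d₂ - d₃ - d₄) ^ 2 ≤ 5 / 2 * d₂ ^ 2 + 5 / 2 * d₃ ^ 2 + 5 * d₄ ^ 2 := by
    linarith [sq_nonneg (2 * d₄ + d₂), sq_nonneg (2 * d₄ - d₃), sq_nonneg (d₂ + d₃)]
  have hac : (d₂ - d₃) ^ 2 ≤ 2 * d₂ ^ 2 + 2 * d₃ ^ 2 := by
    linarith [sq_nonneg (d₂ + d₃)]
  linarith [mul_le_mul_of_nonneg_left hxy (mul_nonneg hs ht),
    mul_le_mul_of_nonneg_left hxb hs, mul_le_mul_of_nonneg_left hxc hs,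
    mul_le_mul_of_nonneg_left hyb ht, mul_le_mul_of_nonneg_left hya ht]

lemma leaf_coefficient_le {s t : ℝ} (hs : 0 ≤ s) (ht : 0 ≤ t) :
    6 * (s * t) + 9 * s ≤ (s + t + 3) * (3 * (s + t + 3) / (2 * s + 1) * s) := by
  have hdiv : (s + t + 3) * (3 * (s + t + 3) / (2 * s + 1) * s) =
      3 * (s + t + 3) ^ 2 * s / (2 * s + 1) := by ring
  rw [hdiv, le_div_iff₀ (by positivity)]
  linarith [mul_nonneg hs (sq_nonneg (s - t)), mul_nonneg hs ht]

lemma bridge_coefficient_le {s t : ℝ} (hs : 0 ≤ s) (ht : 0 ≤ t) :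
    3 * (s * t) + 4 * s + 5 / 2 * t + 3 ≤ (s + t + 3) * (3 * (s + t + 3) / 4) := by
  linarith [sq_nonneg (s - t)]

lemma path_poincare {s t : ℝ} (hs : 0 ≤ s) (ht : 0 ≤ t) {x a b c y : ℝ}
    (hmean : s * x + a + b + c + t * y = 0) :
    s * x ^ 2 + a ^ 2 + b ^ 2 + c ^ 2 + t * y ^ 2 ≤
      3 * (s + t + 3) / (2 * s + 1) * (s * (a - x) ^ 2) +
        3 * (s + t + 3) / 4 * ((b - a) ^ 2 + (b - c) ^ 2) +
        3 * (s + t + 3) / (2 * t + 1) * (t * (c - y) ^ 2) := by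
  have hlagrange : (s + t + 3) * (s * x ^ 2 + a ^ 2 + b ^ 2 + c ^ 2 + t * y ^ 2) =
      s * t * (x - y) ^ 2 + s * ((x - a) ^ 2 + (x - b) ^ 2 + (x - c) ^ 2) +
        t * ((y - c) ^ 2 + (y - b) ^ 2 + (y - a) ^ 2) +
        (a - b) ^ 2 + (b - c) ^ 2 + (a - c) ^ 2 := by
    linear_combination (s * x + a + b + c + t * y) * hmean
  have hx := mul_le_mul_of_nonneg_right (leaf_coefficient_le hs ht) (sq_nonneg (a - x))
  have ha := mul_le_mul_of_nonneg_right (bridge_coefficient_le hs ht) (sq_nonneg (b - a))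
  have hc := mul_le_mul_of_nonneg_right (bridge_coefficient_le ht hs) (sq_nonneg (b - c))
  have hy := mul_le_mul_of_nonneg_right (leaf_coefficient_le ht hs) (sq_nonneg (c - y))
  rw [add_comm t s] at hc hy
  refine le_of_mul_le_mul_left ?_ (by positivity : 0 < s + t + 3)
  rw [hlagrange]
  refine (sum_pairs_le_sum_path hs ht x a b c y).trans ?_
  generalize 3 * (s + t + 3) / (2 * s + 1) = α at *
  generalize 3 * (s + t + 3) / (2 * t + 1) = β at *
  linarith

end PathPoincare

section BridgedStars

open Matrix

variable {n : ℕ}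

/-- Two stars, centred at the first and at the last node, with leaves `1, …, p - 1` and
`p + 1, …, n - 2`; both centres are also joined to the bridge node `p`. -/
def bridgedStars (n p : ℕ) : SimpleGraph (Fin n) :=
  .fromRel fun i j => i.val = 0 ∧ j.val ≤ p ∨ i.val + 1 = n ∧ p ≤ j.val

lemma ncard_symmDiff_bridgedStars_succ {p : ℕ} (hp : p + 1 < n) :
    (symmDiff (bridgedStars n p).edgeSet (bridgedStars n (p + 1)).edgeSet).ncard ≤ 2 := by
  let first : Fin n := ⟨0, by omega⟩
  let last : Fin n := ⟨n - 1, by omega⟩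
  have hsub : symmDiff (bridgedStars n p).edgeSet (bridgedStars n (p + 1)).edgeSet ⊆
      {s(first, ⟨p + 1, hp⟩), s(⟨p, by omega⟩, last)} := by
    intro e
    induction e with | _ i j
    simp only [mem_symmDiff, SimpleGraph.mem_edgeSet, bridgedStars, SimpleGraph.fromRel_adj,
      mem_insert_iff, mem_singleton_iff, Sym2.eq_iff, Fin.ext_iff, first, last, ne_eq]
    omega
  exact (ncard_le_ncard hsub).trans ((ncard_insert_le _ _).trans (by rw [ncard_singleton]))

section Weights

variable {a p c : Fin n}

lemma bridgedStars_eq_sup (ha : a.val = 0) (hc : c.val + 1 = n) (hap : a < p) (hpc : p < c) :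
    bridgedStars n p =
      starOn a (Finset.Ioo a p) ⊔ starOn p {a, c} ⊔ starOn c (Finset.Ioo p c) := by
  ext i j
  simp only [bridgedStars, SimpleGraph.fromRel_adj, SimpleGraph.sup_adj, starOn_adj,
    Finset.mem_Ioo, Finset.mem_insert, Finset.mem_singleton, Fin.ext_iff, Fin.lt_def] at *
  omega

/-- Weights on the edges of `bridgedStars n p` (with `a` and `c` the first and the last node) for
which the nonzero eigenvalues of the Laplacian lie between `1` and `3 n`. -/
noncomputable def bridgedStarsWeight (a p c : Fin n) : Matrix (Fin n) (Fin n) ℝ :=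
  (3 * n / (2 * (Finset.Ioo a p).card + 1) : ℝ) • (starOn a (Finset.Ioo a p)).adjMatrix ℝ +
    (3 * n / 4 : ℝ) • (starOn p {a, c}).adjMatrix ℝ +
    (3 * n / (2 * (Finset.Ioo p c).card + 1) : ℝ) • (starOn c (Finset.Ioo p c)).adjMatrix ℝ

lemma isWeightedAdjacency_bridgedStarsWeight (ha : a.val = 0) (hc : c.val + 1 = n)
    (hap : a < p) (hpc : p < c) :
    IsWeightedAdjacency (bridgedStars n p) (bridgedStarsWeight a p c) := by
  have hn : (0 : ℝ) < n := Nat.cast_pos.2 a.pos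
  rw [bridgedStars_eq_sup ha hc hap hpc]
  exact ((isWeightedAdjacency_smul_adjMatrix (by positivity)).add_smul_adjMatrix
    (by positivity)).add_smul_adjMatrix (by positivity)

lemma dirichletForm_bridgedStarsWeight (hac : a ≠ c) (x : Fin n → ℝ) :
    dirichletForm (bridgedStarsWeight a p c) x =
      3 * n / (2 * (Finset.Ioo a p).card + 1) * ∑ j ∈ Finset.Ioo a p, (x a - x j) ^ 2 +
        3 * n / 4 * ((x p - x a) ^ 2 + (x p - x c) ^ 2) +
        3 * n / (2 * (Finset.Ioo p c).card + 1) * ∑ j ∈ Finset.Ioo p c, (x c - x j) ^ 2 := by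
  rw [bridgedStarsWeight, dirichletForm_add_smul, dirichletForm_add_smul, dirichletForm_smul,
    dirichletForm_starOn, dirichletForm_starOn, dirichletForm_starOn, Finset.sum_pair hac]

lemma sum_eq_add_sum_Ioo (ha : a.val = 0) (hc : c.val + 1 = n) (hap : a < p) (hpc : p < c)
    (f : Fin n → ℝ) :
    ∑ j, f j = f a + f p + f c + ∑ j ∈ Finset.Ioo a p, f j + ∑ j ∈ Finset.Ioo p c, f j := by
  have hdisj : Disjoint (Finset.Ioo a p) (Finset.Ioo p c) :=
    Finset.disjoint_left.2 fun j hj hj' =>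
      lt_asymm (Finset.mem_Ioo.1 hj).2 (Finset.mem_Ioo.1 hj').1
  have huniv : Finset.univ = insert a (insert p (insert c
      (Finset.Ioo a p ∪ Finset.Ioo p c))) := by
    ext j
    simp only [Finset.mem_univ, Finset.mem_insert, Finset.mem_union, Finset.mem_Ioo, true_iff,
      Fin.ext_iff, Fin.lt_def]
    omega
  rw [huniv, Finset.sum_insert, Finset.sum_insert, Finset.sum_insert, Finset.sum_union hdisj]
  · ring
  all_goals
    simp only [Finset.mem_insert, Finset.mem_union, Finset.mem_Ioo, Fin.ext_iff, Fin.lt_def] at *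
    omega

lemma dotProduct_self_eq_add_sum_Ioo (ha : a.val = 0) (hc : c.val + 1 = n) (hap : a < p)
    (hpc : p < c) (x : Fin n → ℝ) :
    x ⬝ᵥ x = x a ^ 2 + x p ^ 2 + x c ^ 2 + ∑ j ∈ Finset.Ioo a p, x j ^ 2 +
      ∑ j ∈ Finset.Ioo p c, x j ^ 2 := by
  simp only [dotProduct, ← sq]
  exact sum_eq_add_sum_Ioo ha hc hap hpc _

lemma dirichletForm_bridgedStarsWeight_le (ha : a.val = 0) (hc : c.val + 1 = n) (hap : a < p)
    (hpc : p < c) (x : Fin n → ℝ) :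
    dirichletForm (bridgedStarsWeight a p c) x ≤ 3 * n * (x ⬝ᵥ x) := by
  have hleaves (S : Finset (Fin n)) (y : ℝ) :
      3 * n / (2 * S.card + 1) * ∑ j ∈ S, (y - x j) ^ 2 ≤
        3 * n * (∑ j ∈ S, x j ^ 2 + y ^ 2 / 2) := by
    rw [div_mul_eq_mul_div, div_le_iff₀ (by positivity)]
    linarith [mul_le_mul_of_nonneg_left (sum_sub_sq_le S x y) (by positivity : (0 : ℝ) ≤ 3 * n)]
  have hbridge (y : ℝ) : 3 * n / 4 * (x p - y) ^ 2 ≤ 3 * n / 4 * (2 * (x p ^ 2 + y ^ 2)) :=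
    mul_le_mul_of_nonneg_left (by linarith [sq_nonneg (x p + y)]) (by positivity)
  rw [dirichletForm_bridgedStarsWeight (hap.trans hpc).ne,
    dotProduct_self_eq_add_sum_Ioo ha hc hap hpc]
  linarith [hleaves (Finset.Ioo a p) (x a), hleaves (Finset.Ioo p c) (x c), hbridge (x a),
    hbridge (x c)]

lemma card_Ioo_add_card_Ioo_add_three (ha : a.val = 0) (hc : c.val + 1 = n) (hap : a < p)
    (hpc : p < c) :
    ((Finset.Ioo a p).card : ℝ) + (Finset.Ioo p c).card + 3 = n := by
  rw [Fin.lt_def] at hap hpc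
  rw [Fin.card_Ioo, Fin.card_Ioo]
  norm_cast
  omega

lemma dotProduct_self_le_dirichletForm_bridgedStarsWeight (ha : a.val = 0) (hc : c.val + 1 = n)
    (hap : (Finset.Ioo a p).Nonempty) (hpc : (Finset.Ioo p c).Nonempty) {x : Fin n → ℝ}
    (hx : x ∈ sumZero n) :
    x ⬝ᵥ x ≤ dirichletForm (bridgedStarsWeight a p c) x := by
  have hlt {i j : Fin n} : (Finset.Ioo i j).Nonempty → i < j := fun ⟨_, hk⟩ =>
    (Finset.mem_Ioo.1 hk).1.trans (Finset.mem_Ioo.1 hk).2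
  have hap' := hlt hap
  have hpc' := hlt hpc
  have hn := card_Ioo_add_card_Ioo_add_three ha hc hap' hpc'
  have hs : (0 : ℝ) < (Finset.Ioo a p).card := Nat.cast_pos.2 hap.card_pos
  have ht : (0 : ℝ) < (Finset.Ioo p c).card := Nat.cast_pos.2 hpc.card_pos
  rw [mem_sumZero, sum_eq_add_sum_Ioo ha hc hap' hpc'] at hx
  have hleft := sum_sq_sub_le_of_one_le hap x (x a)
    (α := 3 * n / (2 * (Finset.Ioo a p).card + 1)) (by
      rw [one_le_div (by positivity)]
      linarith)
  have hright := sum_sq_sub_le_of_one_le hpc x (x c)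
    (α := 3 * n / (2 * (Finset.Ioo p c).card + 1)) (by
      rw [one_le_div (by positivity)]
      linarith)
  have hpath := path_poincare hs.le ht.le
    (x := (∑ j ∈ Finset.Ioo a p, x j) / (Finset.Ioo a p).card) (a := x a) (b := x p) (c := x c)
    (y := (∑ j ∈ Finset.Ioo p c, x j) / (Finset.Ioo p c).card) (by
      rw [mul_div_cancel₀ _ hs.ne', mul_div_cancel₀ _ ht.ne']
      linarith)
  rw [hn] at hpath
  rw [dirichletForm_bridgedStarsWeight (hap'.trans hpc').ne,
    dotProduct_self_eq_add_sum_Ioo ha hc hap' hpc']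
  linarith

end Weights

lemma exists_hasConditionNumber_bridgedStars {p : ℕ} (hp : 2 ≤ p) (hpn : p + 3 ≤ n) {χ : ℝ}
    (hχ : 3 * (n : ℝ) ≤ χ) :
    ∃ W, IsWeightedLaplacianOf (bridgedStars n p) W ∧ IsGossipMatrix (bridgedStars n p) W ∧
      HasConditionNumber W χ := by
  let a : Fin n := ⟨0, by omega⟩
  let b : Fin n := ⟨1, by omega⟩
  let q : Fin n := ⟨p, by omega⟩
  let c : Fin n := ⟨n - 1, by omega⟩
  have hc : c.val + 1 = n := Nat.sub_add_cancel (by omega)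
  have hab : a < b := Fin.mk_lt_mk.2 (by omega)
  have hbq : b < q := Fin.mk_lt_mk.2 (by omega)
  have hqc : q < c := Fin.mk_lt_mk.2 (by omega)
  have hright : (Finset.Ioo q c).Nonempty :=
    ⟨⟨p + 1, by omega⟩, Finset.mem_Ioo.2 ⟨Fin.mk_lt_mk.2 (by omega), Fin.mk_lt_mk.2 (by omega)⟩⟩
  have hA := isWeightedAdjacency_bridgedStarsWeight rfl hc (hab.trans hbq) hqc
  refine hA.exists_hasConditionNumber (r := 1) (a := a) (b := b) (c := q) (d := c) (by linarith)
    one_pos (fun x hx => ?_) (fun x => ?_) ⟨hab.ne, ?_⟩ hqc.ne (hab.trans hbq).ne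
    (hab.trans (hbq.trans hqc)).ne hbq.ne (hbq.trans hqc).ne
  · rw [one_mul]
    exact dotProduct_self_le_dirichletForm_bridgedStarsWeight rfl hc
      ⟨b, Finset.mem_Ioo.2 ⟨hab, hbq⟩⟩ hright hx
  · rw [mul_one]
    exact (dirichletForm_bridgedStarsWeight_le rfl hc (hab.trans hbq) hqc x).trans
      (mul_le_mul_of_nonneg_right hχ (Finset.sum_nonneg fun i _ => mul_self_nonneg _))
  · exact .inl (.inl ⟨rfl, hbq.le⟩)

end BridgedStars

section Schedule

/-- The number of chain coordinates that node `i` of `8 * v` can know after a local computation if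
it knew `m` before. The first `v` nodes hold the links of the chain that lead to even coordinates
(as well as the coordinate `0`), the last `v` nodes those that lead to odd coordinates. -/
def localLevel (v i m : ℕ) : ℕ :=
  if i < v ∧ Even m ∨ 7 * v ≤ i ∧ Odd m then m + 1 else m

/-- The position of the bridge `r` steps after the start of phase `s`: it walks from the first `v`
nodes to the last `v` nodes in an even phase and back in an odd one. -/
def phasePosition (v s r : ℕ) : ℕ :=
  if Even s then v + min r (6 * v - 1) else 7 * v - 1 - min r (6 * v - 1)

/-- The position of the bridge at time `k`. A phase lasts `6 * v + 2` steps: the walk of the bridge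
and two more steps for the information to pass through the centres of the stars. -/
def bridgePosition (v k : ℕ) : ℕ := phasePosition v (k / (6 * v + 2)) (k % (6 * v + 2))

/-- An upper bound for the number of chain coordinates known to node `i`, `r` steps after the start
of phase `s`. The newest coordinate spreads just ahead of the bridge, except that the centre of the
far star can learn it only in the last step of the phase. -/
def phaseLevel (v s r i : ℕ) : ℕ :=
  if Even s then
    if i < v + min r (6 * v) ∨ i + 1 = 8 * v ∧ 6 * v + 1 ≤ r then s + 1 else s
  else
    if 8 * v < i + 1 + v + min r (6 * v) ∨ i = 0 ∧ 6 * v + 1 ≤ r then s + 1 else s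

/-- An upper bound for the number of chain coordinates known to node `i` at time `k`. -/
def level (v k i : ℕ) : ℕ := phaseLevel v (k / (6 * v + 2)) (k % (6 * v + 2)) i

lemma div_mod_succ {T : ℕ} (hT : 0 < T) (k : ℕ) :
    ((k + 1) / T = k / T ∧ (k + 1) % T = k % T + 1 ∧ k % T + 1 < T) ∨
      ((k + 1) / T = k / T + 1 ∧ (k + 1) % T = 0 ∧ k % T + 1 = T) := by
  have hdiv := Nat.div_add_mod k T
  rcases (Nat.succ_le_of_lt (Nat.mod_lt k hT)).lt_or_eq with hlt | heq
  · obtain ⟨hq, hr⟩ := (Nat.div_mod_unique hT).2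
      ⟨show k % T + 1 + T * (k / T) = k + 1 by lia, hlt⟩
    exact Or.inl ⟨hq, hr, hlt⟩
  · obtain ⟨hq, hr⟩ := (Nat.div_mod_unique hT).2
      ⟨show 0 + T * (k / T + 1) = k + 1 by rw [mul_add]; lia, hT⟩
    exact Or.inr ⟨hq, hr, heq⟩

lemma two_le_bridgePosition {v : ℕ} (hv : 2 ≤ v) (k : ℕ) : 2 ≤ bridgePosition v k := by
  unfold bridgePosition phasePosition
  split_ifs <;> lia

lemma bridgePosition_add_three_le {v : ℕ} (hv : 2 ≤ v) (k : ℕ) :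
    bridgePosition v k + 3 ≤ 8 * v := by
  unfold bridgePosition phasePosition
  split_ifs <;> lia

lemma bridgePosition_succ (v k : ℕ) :
    bridgePosition v (k + 1) = bridgePosition v k ∨
      bridgePosition v (k + 1) = bridgePosition v k + 1 ∨
      bridgePosition v k = bridgePosition v (k + 1) + 1 := by
  simp only [bridgePosition]
  rcases div_mod_succ (by lia : 0 < 6 * v + 2) k with ⟨h₁, h₂, h₃⟩ | ⟨h₁, h₂, h₃⟩ <;>
  · rw [h₁, h₂]
    generalize k / (6 * v + 2) = s at *
    generalize k % (6 * v + 2) = r at *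
    simp only [phasePosition, Nat.even_iff]
    split_ifs <;> lia

lemma ncard_symmDiff_bridgedStars_bridgePosition_le {v : ℕ} (hv : 2 ≤ v) (k : ℕ) :
    (symmDiff (bridgedStars (8 * v) (bridgePosition v k)).edgeSet
      (bridgedStars (8 * v) (bridgePosition v (k + 1))).edgeSet).ncard ≤ 2 := by
  have hle := bridgePosition_add_three_le hv k
  have hle' := bridgePosition_add_three_le hv (k + 1)
  rcases bridgePosition_succ v k with h | h | h
  · simp [h]
  · rw [h]
    exact ncard_symmDiff_bridgedStars_succ (by lia)
  · rw [h, symmDiff_comm]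
    exact ncard_symmDiff_bridgedStars_succ (by lia)

lemma exists_forall_hasConditionNumber_bridgePosition {v : ℕ} (hv : 2 ≤ v) {χ : ℝ}
    (hχ : 24 * (v : ℝ) ≤ χ) :
    ∃ W : ℕ → Matrix (Fin (8 * v)) (Fin (8 * v)) ℝ, ∀ k,
      IsWeightedLaplacianOf (bridgedStars (8 * v) (bridgePosition v k)) (W k) ∧
        IsGossipMatrix (bridgedStars (8 * v) (bridgePosition v k)) (W k) ∧
        HasConditionNumber (W k) χ :=
  Classical.skolem.1 fun k => exists_hasConditionNumber_bridgedStars (two_le_bridgePosition hv k)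
    (bridgePosition_add_three_le hv k) (by push_cast; linarith)

lemma level_le (v k i : ℕ) : level v k i ≤ k / (6 * v + 2) + 1 := by
  unfold level phaseLevel
  split_ifs <;> lia

lemma localLevel_level_le {v : ℕ} (hv : 2 ≤ v) (k i : ℕ) :
    localLevel v i (level v k i) ≤ level v (k + 1) i := by
  simp only [level]
  rcases div_mod_succ (by lia : 0 < 6 * v + 2) k with ⟨h₁, h₂, h₃⟩ | ⟨h₁, h₂, h₃⟩ <;>
  · rw [h₁, h₂]
    generalize k / (6 * v + 2) = s at *
    generalize k % (6 * v + 2) = r at *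
    simp only [localLevel, phaseLevel, Nat.even_iff, Nat.odd_iff]
    split_ifs <;> lia

lemma le_localLevel (v i m : ℕ) : m ≤ localLevel v i m := by
  unfold localLevel
  split_ifs <;> lia

lemma level_mono {v : ℕ} (hv : 2 ≤ v) (k i : ℕ) : level v k i ≤ level v (k + 1) i :=
  (le_localLevel v i _).trans (localLevel_level_le hv k i)

lemma level_le_level_succ_of_adj {v : ℕ} (hv : 2 ≤ v) (k : ℕ) {i j : Fin (8 * v)}
    (hij : (bridgedStars (8 * v) (bridgePosition v k)).Adj i j) :
    level v k j ≤ level v (k + 1) i := by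
  obtain ⟨i, hi⟩ := i
  obtain ⟨j, hj⟩ := j
  simp only [bridgedStars, SimpleGraph.fromRel_adj, bridgePosition, ne_eq, Fin.ext_iff] at hij
  simp only [level]
  rcases div_mod_succ (by lia : 0 < 6 * v + 2) k with ⟨h₁, h₂, h₃⟩ | ⟨h₁, h₂, h₃⟩ <;>
  · rw [h₁, h₂]
    generalize k / (6 * v + 2) = s at *
    generalize k % (6 * v + 2) = r at *
    simp only [phasePosition, phaseLevel, Nat.even_iff] at hij ⊢
    split_ifs at hij ⊢ <;> omega

end Schedule

lemma FirstOrderMethod.memory_subset (M : FirstOrderMethod) (P : DecentralizedProblem)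
    (U : ℕ → Fin P.n → Submodule ℝ Ell2) (hstart : ∀ i, M.x₀ ∈ U 0 i)
    (hmono : ∀ k i, U k i ≤ U (k + 1) i)
    (hgradient : ∀ k i, ∀ x ∈ U k i, gradient (P.f i) x ∈ U (k + 1) i)
    (hconjugate : ∀ k i, ∀ x ∈ U k i, gradient (fenchelConjugate (P.f i)) x ∈ U (k + 1) i)
    (hadj : ∀ k i j, (P.G k).Adj i j → U k j ≤ U (k + 1) i) (k : ℕ) (i : Fin P.n) :
    M.memory P k i ⊆ U k i := by
  induction k generalizing i with
  | zero => simpa [M.memory_zero P i] using hstart i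
  | succ k ih =>
    by_cases hcomm : M.isComm P k
    · refine (M.memory_comm P k hcomm i).trans
        (SetLike.coe_subset_coe.2 (Submodule.span_le.2 (iUnion₂_subset fun j hj => ?_)))
      rcases hj with hij | rfl
      · exact (ih j).trans (hadj k i j hij)
      · exact (ih j).trans (hmono k j)
    · refine (M.memory_local P k hcomm i).trans
        (SetLike.coe_subset_coe.2 (Submodule.span_le.2 (iUnion₂_subset fun x hx => ?_)))
      rintro y (rfl | rfl | rfl)
      · exact hmono k i (ih i hx)
      · exact hgradient k i x (ih i hx)
      · exact hconjugate k i x (ih i hx)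

lemma DecentralizedProblem.globalFunction_le_of_sum_gradient_eq_zero (P : DecentralizedProblem)
    {μ : ℝ} (hμ : 0 ≤ μ) (hP : ∀ i, IsMuStronglyConvex μ (P.f i)) {xs : Ell2}
    (hxs : ∑ i, gradient (P.f i) xs = 0) (x : Ell2) :
    P.globalFunction xs ≤ P.globalFunction x := by
  have htangent : ∑ i, (P.f i xs + inner ℝ (gradient (P.f i) xs) (x - xs)) ≤ ∑ i, P.f i x :=
    Finset.sum_le_sum fun i _ => (le_add_of_nonneg_right (by positivity)).trans ((hP i).2 xs x)
  rw [Finset.sum_add_distrib, ← sum_inner, hxs, inner_zero_left, add_zero] at htangent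
  exact mul_le_mul_of_nonneg_left htangent (by positivity)

section ChainProblem

/-- The projection in the objective of node `i`: the first `v` nodes hold the odd links
`e 1 - e 2`, `e 3 - e 4`, … of the chain, the nodes from `7 * v` on the even ones. -/
noncomputable def nodeProjection (e : ℕ → Ell2) (v i : ℕ) : Ell2 →L[ℝ] Ell2 :=
  if i < v then linkProjection e 1 else if 7 * v ≤ i then linkProjection e 0 else 0

/-- The linear term in the objective of node `i`: it pulls the coordinate `0` away from the
starting point. -/
noncomputable def nodeOffset (e : ℕ → Ell2) (v : ℕ) (β : ℝ) (i : ℕ) : Ell2 :=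
  if i < v then β • e 0 else 0

/-- The local function of node `i`. -/
noncomputable def nodeObjective (e : ℕ → Ell2) (x₀ : Ell2) (v : ℕ) (μ g β : ℝ) (i : ℕ) :
    Ell2 → ℝ :=
  quadraticObjective (shiftedProjection (nodeProjection e v i) μ g) (nodeOffset e v β i) x₀

/-- The hard instance: a chain of quadratic links whose halves are held by two groups of `v` nodes,
on bridged stars whose bridge walks back and forth between the groups. The coefficients `16 * c` and
`8 * (μ + c * (1 - q))` make up for only one node in eight holding each half. -/
noncomputable def chainProblem (e : ℕ → Ell2) (x₀ : Ell2) (v : ℕ) (μ c q : ℝ)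
    (W : ℕ → Matrix (Fin (8 * v)) (Fin (8 * v)) ℝ) : DecentralizedProblem where
  n := 8 * v
  f i := nodeObjective e x₀ v μ (16 * c) (8 * (μ + c * (1 - q))) i
  G k := bridgedStars (8 * v) (bridgePosition v k)
  W := W

variable {e : ℕ → Ell2} {x₀ : Ell2} {μ g L : ℝ}

lemma nodeProjection_isStarProjection (e : ℕ → Ell2) (v i : ℕ) :
    IsStarProjection (nodeProjection e v i) := by
  unfold nodeProjection
  split_ifs
  · exact linkProjection_isStarProjection e 1
  · exact linkProjection_isStarProjection e 0
  · exact .zero _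

lemma nodeProjection_nodeOffset (he : Orthonormal ℝ e) (v : ℕ) (β : ℝ) (i : ℕ) :
    nodeProjection e v i (nodeOffset e v β i) = 0 := by
  unfold nodeProjection nodeOffset
  split_ifs <;> simp [linkProjection_of_lt he one_pos]

lemma nodeProjection_mem_krylov (he : Orthonormal ℝ e) (h₀ : ∀ i, inner ℝ (e i) x₀ = 0)
    (v i : ℕ) {m : ℕ} {x : Ell2} (hx : x ∈ krylov e x₀ m) :
    nodeProjection e v i x ∈ krylov e x₀ (localLevel v i m) := by
  unfold nodeProjection localLevel
  split_ifs
  · exact linkProjection_mem_krylov_succ he h₀ 1 hx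
  · exact linkProjection_mem_krylov_succ he h₀ 0 hx
  · exact Submodule.zero_mem _
  · exact linkProjection_mem_krylov_of_even he h₀ (by grind) hx
  · exact linkProjection_mem_krylov_of_even he h₀ (by grind) hx
  · exact Submodule.zero_mem _

lemma nodeOffset_mem_krylov (e : ℕ → Ell2) (x₀ : Ell2) (v : ℕ) (β : ℝ) (i m : ℕ) :
    nodeOffset e v β i ∈ krylov e x₀ (localLevel v i m) := by
  unfold nodeOffset localLevel
  split_ifs
  · exact Submodule.smul_mem _ _ (mem_krylov_of_lt m.succ_pos)
  · exact Submodule.zero_mem _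
  · have hm : 0 < m := by grind
    exact Submodule.smul_mem _ _ (mem_krylov_of_lt hm)
  · exact Submodule.zero_mem _

lemma isLSmooth_nodeObjective (hμ : 0 ≤ μ) (hg : 0 ≤ g) (hL : μ + g ≤ L) (e : ℕ → Ell2)
    (x₀ : Ell2) (v : ℕ) (β : ℝ) (i : ℕ) : IsLSmooth L (nodeObjective e x₀ v μ g β i) :=
  have hP := nodeProjection_isStarProjection e v i
  isLSmooth_quadraticObjective (shiftedProjection_isSymmetric hP μ g)
    ((norm_shiftedProjection_le hP hμ hg).trans hL) _ _

lemma isMuStronglyConvex_nodeObjective (μ : ℝ) (hg : 0 ≤ g) (e : ℕ → Ell2) (x₀ : Ell2) (v : ℕ)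
    (β : ℝ) (i : ℕ) : IsMuStronglyConvex μ (nodeObjective e x₀ v μ g β i) :=
  have hP := nodeProjection_isStarProjection e v i
  isMuStronglyConvex_quadraticObjective (shiftedProjection_isSymmetric hP μ g)
    (le_inner_shiftedProjection hP μ hg) _ _

lemma gradient_nodeObjective (e : ℕ → Ell2) (x₀ : Ell2) (v : ℕ) (μ g β : ℝ) (i : ℕ) (x : Ell2) :
    gradient (nodeObjective e x₀ v μ g β i) x =
      shiftedProjection (nodeProjection e v i) μ g (x - x₀) - nodeOffset e v β i :=
  (hasGradientAt_quadraticObjective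
    (shiftedProjection_isSymmetric (nodeProjection_isStarProjection e v i) μ g) _ _ x).gradient

lemma gradient_fenchelConjugate_nodeObjective (hμ : 0 < μ) (hg : 0 ≤ g) (e : ℕ → Ell2)
    (x₀ : Ell2) (v : ℕ) (β : ℝ) (i : ℕ) (y : Ell2) :
    gradient (fenchelConjugate (nodeObjective e x₀ v μ g β i)) y =
      shiftedProjection (nodeProjection e v i) μ⁻¹ ((μ + g)⁻¹ - μ⁻¹) (y + nodeOffset e v β i) +
        x₀ :=
  have hP := nodeProjection_isStarProjection e v i
  gradient_fenchelConjugate_quadraticObjective (shiftedProjection_isPositive hP hμ.le hg)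
    (shiftedProjection_isSymmetric hP _ _)
    (shiftedProjection_mul_inverse hP.isIdempotentElem hμ.ne' (by positivity)) _ _ y

lemma gradient_nodeObjective_mem_krylov (he : Orthonormal ℝ e) (h₀ : ∀ i, inner ℝ (e i) x₀ = 0)
    (v : ℕ) (μ g β : ℝ) (i : ℕ) {m : ℕ} {x : Ell2} (hx : x ∈ krylov e x₀ m) :
    gradient (nodeObjective e x₀ v μ g β i) x ∈ krylov e x₀ (localLevel v i m) := by
  have hsub : x - x₀ ∈ krylov e x₀ m := Submodule.sub_mem _ hx (start_mem_krylov e x₀ m)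
  rw [gradient_nodeObjective]
  exact Submodule.sub_mem _
    (shiftedProjection_mem (krylov_mono e x₀ (le_localLevel v i m) hsub)
      (nodeProjection_mem_krylov he h₀ v i hsub) μ g)
    (nodeOffset_mem_krylov e x₀ v β i m)

lemma gradient_fenchelConjugate_nodeObjective_mem_krylov (he : Orthonormal ℝ e)
    (h₀ : ∀ i, inner ℝ (e i) x₀ = 0) (hμ : 0 < μ) (hg : 0 ≤ g) (v : ℕ) (β : ℝ) (i : ℕ) {m : ℕ}
    {x : Ell2} (hx : x ∈ krylov e x₀ m) :
    gradient (fenchelConjugate (nodeObjective e x₀ v μ g β i)) x ∈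
      krylov e x₀ (localLevel v i m) := by
  have hproj : nodeProjection e v i (x + nodeOffset e v β i) = nodeProjection e v i x := by
    rw [map_add, nodeProjection_nodeOffset he, add_zero]
  rw [gradient_fenchelConjugate_nodeObjective hμ hg]
  refine Submodule.add_mem _ (shiftedProjection_mem (Submodule.add_mem _
    (krylov_mono e x₀ (le_localLevel v i m) hx) (nodeOffset_mem_krylov e x₀ v β i m)) ?_ _ _)
    (start_mem_krylov e x₀ _)
  rw [hproj]
  exact nodeProjection_mem_krylov he h₀ v i hx

lemma memory_chainProblem_subset_krylov (M : FirstOrderMethod) (he : Orthonormal ℝ e)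
    (h₀ : ∀ i, inner ℝ (e i) M.x₀ = 0) (hμ : 0 < μ) {c : ℝ} (hc : 0 ≤ c) (q : ℝ) {v : ℕ}
    (hv : 2 ≤ v) (W : ℕ → Matrix (Fin (8 * v)) (Fin (8 * v)) ℝ) (k : ℕ) (i : Fin (8 * v)) :
    M.memory (chainProblem e M.x₀ v μ c q W) k i ⊆ krylov e M.x₀ (level v k i) := by
  have hmono := krylov_mono e M.x₀
  refine M.memory_subset (chainProblem e M.x₀ v μ c q W)
    (fun k (i : Fin (8 * v)) => krylov e M.x₀ (level v k i)) (fun i => start_mem_krylov e M.x₀ _)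
    (fun k i => hmono (level_mono hv k i.val))
    (fun k i x hx => hmono (localLevel_level_le hv k i.val) ?_)
    (fun k i x hx => hmono (localLevel_level_le hv k i.val) ?_)
    (fun k i j hij => hmono (level_le_level_succ_of_adj hv k hij)) k i
  · exact gradient_nodeObjective_mem_krylov he h₀ _ _ _ _ _ hx
  · exact gradient_fenchelConjugate_nodeObjective_mem_krylov he h₀ hμ (by positivity) _ _ _ hx

lemma sum_fin_eq_of_three_blocks {E : Type*} [AddCommMonoid E] {a b c n : ℕ} (hn : a + b + c = n)
    {F : ℕ → E} {x y z : E} (hx : ∀ i < a, F i = x) (hy : ∀ i < b, F (a + i) = y)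
    (hz : ∀ i < c, F (a + b + i) = z) : ∑ i : Fin n, F i = a • x + b • y + c • z := by
  subst hn
  rw [Fin.sum_univ_eq_sum_range F, Finset.sum_range_add, Finset.sum_range_add,
    Finset.sum_congr rfl fun i hi => hx i (Finset.mem_range.1 hi),
    Finset.sum_congr rfl fun i hi => hy i (Finset.mem_range.1 hi),
    Finset.sum_congr rfl fun i hi => hz i (Finset.mem_range.1 hi)]
  simp only [Finset.sum_const, Finset.card_range]

lemma sum_gradient_nodeObjective (he : Orthonormal ℝ e) {q c : ℝ} (h0 : 0 < q) (h1 : q < 1)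
    (hc : c * (1 - q) ^ 2 = μ * q) (x₀ : Ell2) (v : ℕ) :
    ∑ i : Fin (8 * v), gradient (nodeObjective e x₀ v μ (16 * c) (8 * (μ + c * (1 - q))) i)
      (x₀ + geometricVector e q) = 0 := by
  have hstationary := chain_stationary he h0 h1 hc
  simp only [gradient_nodeObjective, add_sub_cancel_left, shiftedProjection_apply]
  set y := geometricVector e q
  set β := 8 * (μ + c * (1 - q))
  rw [sum_fin_eq_of_three_blocks (show v + 6 * v + v = 8 * v by ring)
    (F := fun i => μ • y + (16 * c) • nodeProjection e v i y - nodeOffset e v β i)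
    (x := μ • y + (16 * c) • linkProjection e 1 y - β • e 0) (y := μ • y)
    (z := μ • y + (16 * c) • linkProjection e 0 y)
    (fun i hi => by simp [nodeProjection, nodeOffset, hi])
    (fun i _ => by simp [nodeProjection, nodeOffset, show ¬ 7 * v ≤ v + i by lia])
    (fun i _ => by simp [nodeProjection, nodeOffset, show ¬ v + 6 * v + i < v by lia,
      show 7 * v ≤ v + 6 * v + i by lia])]
  simp only [← Nat.cast_smul_eq_nsmul ℝ, Nat.cast_mul, Nat.cast_ofNat]
  rw [add_apply] at hstationary
  linear_combination (norm := module) (8 * v : ℝ) • hstationary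

lemma globalFunction_chainProblem_le (he : Orthonormal ℝ e) {q c : ℝ} (h0 : 0 < q) (h1 : q < 1)
    (hμ : 0 ≤ μ) (hc0 : 0 ≤ c) (hc : c * (1 - q) ^ 2 = μ * q) (x₀ : Ell2) (v : ℕ)
    (W : ℕ → Matrix (Fin (8 * v)) (Fin (8 * v)) ℝ) (x : Ell2) :
    (chainProblem e x₀ v μ c q W).globalFunction (x₀ + geometricVector e q) ≤
      (chainProblem e x₀ v μ c q W).globalFunction x :=
  DecentralizedProblem.globalFunction_le_of_sum_gradient_eq_zero _ hμ
    (fun i => isMuStronglyConvex_nodeObjective μ (by positivity) e x₀ v _ i.val)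
    (sum_gradient_nodeObjective he h0 h1 hc x₀ v) x

lemma norm_sub_ge_of_mem_memory_chainProblem (M : FirstOrderMethod) (he : Orthonormal ℝ e)
    (h₀ : ∀ i, inner ℝ (e i) M.x₀ = 0) {q c : ℝ} (h0 : 0 ≤ q) (h1 : q < 1) (hμ : 0 < μ)
    (hc : 0 ≤ c) {v : ℕ} (hv : 2 ≤ v) {W : ℕ → Matrix (Fin (8 * v)) (Fin (8 * v)) ℝ} {k : ℕ}
    {i : Fin (8 * v)} {x : Ell2} (hx : x ∈ M.memory (chainProblem e M.x₀ v μ c q W) k i) :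
    q ^ (2 * (k / (6 * v + 2) + 1)) * ‖geometricVector e q‖ ^ 2 ≤
      ‖x - (M.x₀ + geometricVector e q)‖ ^ 2 :=
  norm_sub_geometricVector_ge he h₀ h0 h1 (krylov_mono e M.x₀ (level_le v k i.val)
    (memory_chainProblem_subset_krylov M he h₀ hμ hc q hv W k i hx))

end ChainProblem

lemma one_sub_four_mul_sqrt_div_pos {L μ : ℝ} (hμ : 0 < μ) (hL : 16 * μ < L) :
    0 < 1 - 4 * √(μ / L) := by
  have hsqrt : √(μ / L) < 1 / 4 := by
    rw [Real.sqrt_lt' (by norm_num), div_lt_iff₀ (by linarith)]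
    linarith
  linarith

lemma exists_chain_coefficient {L μ q : ℝ} (hμ : 0 < μ) (hL : 16 * μ < L)
    (hq : q = 1 - 4 * √(μ / L)) :
    ∃ c : ℝ, 0 ≤ c ∧ μ + 16 * c ≤ L ∧ c * (1 - q) ^ 2 = μ * q := by
  have hL0 : 0 < L := by linarith
  have hq0 : 0 < q := hq ▸ one_sub_four_mul_sqrt_div_pos hμ hL
  have hsq : √(μ / L) ^ 2 * L = μ := by
    rw [Real.sq_sqrt (by positivity), div_mul_cancel₀ _ hL0.ne']
  refine ⟨q * L / 16, by positivity, ?_, ?_⟩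
  · have hμL : μ ≤ √(μ / L) * L := by
      nth_rw 1 [← hsq]
      gcongr
      exact pow_le_of_le_one (Real.sqrt_nonneg _) (by linarith) two_ne_zero
    rw [hq]
    linarith
  · rw [hq]
    linear_combination (1 - 4 * √(μ / L)) * hsq

lemma rpow_le_pow_div_add_one {q t : ℝ} (hq0 : 0 < q) (hq1 : q ≤ 1) {T : ℕ} (ht : 0 < t)
    (htT : t ≤ T) (k : ℕ) :
    q ^ (2 * ((k : ℝ) / t + 1)) ≤ q ^ (2 * (k / T + 1)) := by
  rw [← Real.rpow_natCast]
  refine Real.rpow_le_rpow_of_exponent_ge hq0 hq1 ?_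
  have hdiv : ((k / T : ℕ) : ℝ) ≤ (k : ℝ) / t := Nat.cast_div_le.trans (by gcongr)
  push_cast
  linarith

/-- The ratio `24 * (v + 1) / (6 * v + 2)`, which bounds `χ / (6 * v + 2)`, is largest at `v = 2`,
where it equals `36 / 7`. -/
lemma exists_nat_le_and_le_phase_length {χ : ℝ} (hχ : 48 ≤ χ) :
    ∃ v : ℕ, 2 ≤ v ∧ 24 * (v : ℝ) ≤ χ ∧ 7 * χ / 36 ≤ (6 * v + 2 : ℕ) := by
  have hv : 2 ≤ ⌊χ / 24⌋₊ := Nat.le_floor (by push_cast; linarith)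
  have hv' : (2 : ℝ) ≤ ⌊χ / 24⌋₊ := by exact_mod_cast hv
  have hle : (⌊χ / 24⌋₊ : ℝ) ≤ χ / 24 := Nat.floor_le (by positivity)
  have hlt : χ / 24 < ⌊χ / 24⌋₊ + 1 := Nat.lt_floor_add_one _
  refine ⟨⌊χ / 24⌋₊, hv, by linarith, ?_⟩
  push_cast
  linarith

theorem mainTheorem4_general (χ L μ : ℝ) (hχ : 48 ≤ χ) (hμ : 0 < μ) (hL : 16 * μ < L)
    (M : FirstOrderMethod) :
    ∃ P : DecentralizedProblem,
      (∀ i, IsLSmooth L (P.f i)) ∧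
      (∀ i, IsMuStronglyConvex μ (P.f i)) ∧
      (∀ k, (symmDiff (P.G k).edgeSet (P.G (k + 1)).edgeSet).ncard ≤ 2) ∧
      (∀ k, IsWeightedLaplacianOf (P.G k) (P.W k) ∧ IsGossipMatrix (P.G k) (P.W k) ∧
        HasConditionNumber (P.W k) χ) ∧
      ∃ xs : Ell2, (∀ x, P.globalFunction xs ≤ P.globalFunction x) ∧ xs ≠ M.x₀ ∧
        ∀ (k : ℕ) (i : Fin P.n), ∀ x ∈ M.memory P k i,
          (1 - 4 * Real.sqrt (μ / L)) ^ (72 * (k : ℝ) / (7 * χ) + 2) * ‖M.x₀ - xs‖ ^ 2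
            ≤ ‖x - xs‖ ^ 2 := by
  obtain ⟨v, hv, hvχ, hχv⟩ := exists_nat_le_and_le_phase_length hχ
  obtain ⟨q, hq⟩ : ∃ q, q = 1 - 4 * √(μ / L) := ⟨_, rfl⟩
  have hq0 : 0 < q := hq ▸ one_sub_four_mul_sqrt_div_pos hμ hL
  have hq1 : q < 1 := by
    have := Real.sqrt_pos.2 (div_pos hμ (by linarith : 0 < L))
    linarith
  obtain ⟨c, hc0, hcL, hc⟩ := exists_chain_coefficient hμ hL hq
  obtain ⟨e, he, h₀⟩ := exists_orthonormal_sequence_orthogonal not_finiteDimensional_ell2 M.x₀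
  obtain ⟨W, hW⟩ := exists_forall_hasConditionNumber_bridgePosition hv hvχ
  refine ⟨chainProblem e M.x₀ v μ c q W,
    fun i => isLSmooth_nodeObjective hμ.le (by positivity) hcL e M.x₀ v _ i.val,
    fun i => isMuStronglyConvex_nodeObjective μ (by positivity) e M.x₀ v _ i.val,
    ncard_symmDiff_bridgedStars_bridgePosition_le hv, hW, M.x₀ + geometricVector e q,
    globalFunction_chainProblem_le he hq0 hq1 hμ.le hc0 hc M.x₀ v W,
    by simpa using geometricVector_ne_zero he hq0.le hq1, fun k i x hx => ?_⟩
  have hexponent : 72 * (k : ℝ) / (7 * χ) + 2 = 2 * (k / (7 * χ / 36) + 1) := by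
    field_simp
    ring
  rw [← hq, hexponent, sub_add_cancel_left, norm_neg]
  exact (mul_le_mul_of_nonneg_right
    (rpow_le_pow_div_add_one hq0 hq1.le (by positivity) hχv k) (sq_nonneg _)).trans
    (norm_sub_ge_of_mem_memory_chainProblem M he h₀ hq0.le hq1 hμ hc0 hv hx)

theorem mainTheorem4 (χ L μ : ℝ) (hχ : 56 ≤ χ) (hμ : 0 < μ) (hL : 16 * μ < L)
    (M : FirstOrderMethod) :
    ∃ P : DecentralizedProblem,
      (∀ i, IsLSmooth L (P.f i)) ∧
      (∀ i, IsMuStronglyConvex μ (P.f i)) ∧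
      (∀ k, (symmDiff (P.G k).edgeSet (P.G (k + 1)).edgeSet).ncard ≤ 2) ∧
      (∀ k, IsWeightedLaplacianOf (P.G k) (P.W k) ∧ IsGossipMatrix (P.G k) (P.W k) ∧
        HasConditionNumber (P.W k) χ) ∧
      ∃ xs : Ell2, (∀ x, P.globalFunction xs ≤ P.globalFunction x) ∧ xs ≠ M.x₀ ∧
        ∀ (k : ℕ) (i : Fin P.n), ∀ x ∈ M.memory P k i,
          (1 - 4 * Real.sqrt (μ / L)) ^ (72 * (k : ℝ) / (7 * χ) + 2) * ‖M.x₀ - xs‖ ^ 2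
            ≤ ‖x - xs‖ ^ 2 :=
  mainTheorem4_general χ L μ (by linarith) hμ hL M
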